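/- **Film surfaces.** Fix a set $S$ of colours. A *coloured graph* is a connected finite graph without loops (parallel edges allowed), with at least one edge, with oriented edges and with pairwise different colours $s(l)\in S$ of its edges $l$. $\Sigma$ is the set of isomorphism classes of coloured graphs (isomorphisms preserve colours and orientations), and $\sigma\mapsto\sigma^*$ is the inversion of all orientations. A *connected film surface* $\Omega$ is a connected complex glued from finitely many oriented disks of pairwise different colours along a finite graph $\Delta$ without loops, each boundary circle being mapped homeomorphically onto a cycle of $\Delta$ and these cycles covering $\Delta$, together with a cyclic order on the vertices such that every disk passes its vertices in the cyclic order, and such that every division of the vertices into two nonempty arcs of the cyclic order is realized by a *graph-cut*: a connected graph $\gamma\subset\Omega$ without loops that meets every disk in the empty set or in one edge of $\gamma$ and divides $\Omega$ into two connected parts containing the two arcs. A *film surface* is a finite disjoint union of connected ones; isomorphisms are homeomorphisms that preserve the cyclic orders and the orientations and colours of the disks. The *vertex graph* of a vertex $q$ is the boundary of a small neighbourhood of $q$: its vertices lie on the edges of $\Omega$ at $q$, its edges lie in the disks at $q$, have their colours, and are oriented as boundary arcs of the parts of the disks outside the neighbourhood; $\sigma_q\in\Sigma$ is its class. Cutting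 $\Omega$ along $\gamma$ and contracting the two copies of $\gamma$ to points $q_+$, $q_-$ gives a film surface $\Omega[\gamma]$ with two components and $\sigma_{q_-}=\sigma_{q_+}^*$. **Film Topological Field Theories.** Let $\mathbb K$ be a field of characteristic $0$. A Film Topological Field Theory on finite-dimensional spaces $B_\sigma$ and tensors $K_\sigma\in B_\sigma\otimes B_{\sigma^*}$ ($\sigma\in\Sigma$) is a family of linear forms $\Phi_\Omega:V_\Omega=\bigotimes_{q}B_{\sigma_q}\to\mathbb K$ ($q$ runs over the vertices of $\Omega$), for all film surfaces $\Omega$, such that: (1) $\Phi_{\Omega'}(\phi_*x)=\Phi_\Omega(x)$ for all isomorphisms $\phi:\Omega\to\Omega'$; (2) for every connected $\Omega$ with just two vertices $q_1,q_2$ and $\sigma=\sigma_{q_1}$ the form $(x,y)_\sigma=\Phi_\Omega(x_{q_1}\otimes y_{q_2})$ on $B_\sigma\times B_{\sigma^*}$ is nondegenerate; (3) $\Phi_{\Omega[\gamma]}(x\otimes K_\sigma)=\Phi_\Omega(x)$ for every graph-cut $\gamma$ of a connected $\Omega$, where $\sigma=\sigma_{q_+}$; (4) $\Phi_{\Omega'\sqcup\Omega''}(x'\otimes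 x'')=\Phi_{\Omega'}(x')\Phi_{\Omega''}(x'')$. **Equipments.** For every $s\in S$ let a finite group $G_s$ act on a finite set $X_s$, and let $G=\bigoplus_{s\in S}G_s$. An *equipment* of a coloured graph $\sigma$ is a $G$-orbit of maps $\psi$ that send each edge $l$ to a pair in $X_{s(l)}\times X_{s(l)}$; $E_\sigma$ is the set of equipments of $\sigma$, $B_\sigma$ is the $\mathbb K$-vector space with the basis $E_\sigma$, and $*:E_\sigma\to E_{\sigma^*}$ is given by swapping the components of the pairs. An *equipment* of a connected film surface $\Omega$ is a $G$-orbit of maps $\psi$ that send each edge $e$ of $\Omega$ to an element of $\prod_s X_s$, where $s$ runs over the colours of the disks incident to $e$. It generates an equipment of the graph of every vertex $q$: an edge of colour $s$ that goes from $e_1$ to $e_2$ is sent to the pair of the components of colour $s$ of $\psi(e_1)$, $\psi(e_2)$. For an equipment with representative $\psi$ let $|\mathrm{Aut}|$ be the order of $\{g\in G_T\mid g\psi=\psi\}$, where $T$ is the set of colours of the graph or surface and $G_T=\bigoplus_{s\in T}G_s$. (If $G$ is finite, one may alternatively take stabilizers in the whole group $G$ for all graphs and surfaces; the lemma holds for both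 conventions.) **Lemma.** For a connected film surface $\Omega$ and equipments $\varsigma_q\in E_{\sigma_q}$ of the graphs of its vertices put $$\Phi_\Omega\Big(\bigotimes_q\varsigma_q\Big)=\sum_{\Psi}\frac1{|\mathrm{Aut}(\Psi)|},$$ where $\Psi$ runs over the equipments of $\Omega$ that generate $\varsigma_q$ at every vertex $q$, extend $\Phi_\Omega$ linearly to $V_\Omega$, and extend the family to all film surfaces by multiplicativity over connected components. Then $\{\Phi_\Omega\}$ is a Film Topological Field Theory with the tensors $K_\sigma=\sum_{\varsigma\in E_\sigma}|\mathrm{Aut}(\varsigma)|\,\varsigma\otimes\varsigma^*$, and its pairing is $$(\varsigma_1,\varsigma_2^*)_\sigma=\frac{\delta_{\varsigma_1,\varsigma_2}}{|\mathrm{Aut}(\varsigma_1)|}\qquad(\varsigma_1,\varsigma_2\in E_\sigma).$$ -/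

import Mathlib

open scoped TensorProduct

universe u v w z

/-! ### Coloured graphs and their isomorphism classes -/

/-- A connected regular oriented coloured graph: finitely many edges (at least one), each of them an
oriented segment (no loops, parallel edges allowed), with pairwise different colours in `S`. -/
structure ColoredGraph (S : Type u) where
  Vtx : Type u
  Edge : Type u
  finite_edge : Finite Edge
  nonempty_edge : Nonempty Edge
  color : Edge → S
  color_injective : Function.Injective color
  src : Edge → Vtx
  tgt : Edge → Vtx
  src_ne_tgt : ∀ l, src l ≠ tgt l
  connected : ∀ p q, Relation.ReflTransGen
    (fun p q => ∃ l, (src l = p ∧ tgt l = q) ∨ (src l = q ∧ tgt l = p)) p q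

/-- Isomorphisms of coloured graphs: they preserve colours and orientations. -/
structure ColoredGraph.Iso {S : Type u} (Γ Γ' : ColoredGraph S) where
  vtx : Γ.Vtx ≃ Γ'.Vtx
  edge : Γ.Edge ≃ Γ'.Edge
  color_edge : ∀ l, Γ'.color (edge l) = Γ.color l
  src_edge : ∀ l, Γ'.src (edge l) = vtx (Γ.src l)
  tgt_edge : ∀ l, Γ'.tgt (edge l) = vtx (Γ.tgt l)

/-- The end of an oriented edge: the terminal one for `true`, the initial one for `false`. -/
def ColoredGraph.endpt {S : Type u} (Γ : ColoredGraph S) (l : Γ.Edge) (b : Bool) : Γ.Vtx :=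
  if b then Γ.tgt l else Γ.src l

/-- The set `Σ` of isomorphism classes of connected oriented coloured graphs.  Since the edges of a
connected coloured graph have different colours, an edge may be identified with its colour `s`, its
initial and terminal ends with `(s, false)` and `(s, true)`, and a vertex with the set of the ends
that meet there.  So an isomorphism class is a partition of the ends of a finite nonempty set of
colours into vertices; `glue x y` says that `x` and `y` are ends of edges of the graph that meet in
a vertex.  See `ColoredGraph.toClass_eq_iff` and `ColoredGraph.toClass_surjective`. -/
@[ext]
structure GraphClass (S : Type u) where
  glue : S × Bool → S × Bool → Prop
  symm : ∀ {x y}, glue x y → glue y x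
  trans : ∀ {x y z}, glue x y → glue y z → glue x z
  flip : ∀ {s b}, glue (s, b) (s, b) → glue (s, !b) (s, !b)
  regular : ∀ s b, ¬ glue (s, b) (s, !b)
  finite : {s | glue (s, false) (s, false)}.Finite
  nonempty : ∃ s, glue (s, false) (s, false)
  connected : ∀ x y, glue x x → glue y y →
    Relation.ReflTransGen (fun x y => glue x y ∨ y = (x.1, !x.2)) x y

namespace ColoredGraph

variable {S : Type u} (Γ Γ' : ColoredGraph S)

/-- The isomorphism class of a coloured graph. -/
def toClass : GraphClass S where
  glue x y := ∃ l m, Γ.color l = x.1 ∧ Γ.color m = y.1 ∧ Γ.endpt l x.2 = Γ.endpt m y.2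
  symm := by
    rintro x y ⟨l, m, h1, h2, h3⟩
    exact ⟨m, l, h2, h1, h3.symm⟩
  trans := by
    rintro x y z ⟨l, m, h1, h2, h3⟩ ⟨m', n, h4, h5, h6⟩
    obtain rfl : m = m' := Γ.color_injective (h2.trans h4.symm)
    exact ⟨l, n, h1, h5, h3.trans h6⟩
  flip := by
    rintro s b ⟨l, m, h1, h2, -⟩
    exact ⟨l, l, h1, h1, rfl⟩
  regular := by
    rintro s b ⟨l, m, h1, h2, h3⟩
    obtain rfl : l = m := Γ.color_injective (h1.trans h2.symm)
    have := Γ.src_ne_tgt l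
    cases b <;> simp [endpt] at h3
    · exact this h3
    · exact this h3.symm
  finite := by
    have := Γ.finite_edge
    refine (Set.finite_range Γ.color).subset ?_
    rintro s ⟨l, m, h1, h2, -⟩
    exact ⟨l, h1⟩
  nonempty := by
    obtain ⟨l⟩ := Γ.nonempty_edge
    exact ⟨Γ.color l, l, l, rfl, rfl, rfl⟩
  connected := by
    rintro ⟨s, b⟩ ⟨t, c⟩ ⟨l, -, rfl, -, -⟩ ⟨m, -, rfl, -, -⟩
    have key : ∀ p q, Relation.ReflTransGen
        (fun p q => ∃ l, (Γ.src l = p ∧ Γ.tgt l = q) ∨ (Γ.src l = q ∧ Γ.tgt l = p)) p q →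
        ∀ l b m c, Γ.endpt l b = p → Γ.endpt m c = q →
        Relation.ReflTransGen (fun x y : S × Bool => (∃ l m, Γ.color l = x.1 ∧ Γ.color m = y.1 ∧
          Γ.endpt l x.2 = Γ.endpt m y.2) ∨ y = (x.1, !x.2)) (Γ.color l, b) (Γ.color m, c) := by
      intro p q h
      induction h with
      | refl =>
        intro l b m c h1 h2
        exact Relation.ReflTransGen.single (Or.inl ⟨l, m, rfl, rfl, h1.trans h2.symm⟩)
      | tail _ h ih =>
        intro l b m c h1 h2
        obtain ⟨n, ⟨h3, h4⟩ | ⟨h3, h4⟩⟩ := h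
        · refine ((ih l b n false h1 (by simpa [endpt] using h3)).tail (c := (Γ.color n, true))
            (Or.inr rfl)).tail (Or.inl ⟨n, m, rfl, rfl, ?_⟩)
          simp only [h2]; simpa [endpt] using h4
        · refine ((ih l b n true h1 (by simpa [endpt] using h4)).tail (c := (Γ.color n, false))
            (Or.inr rfl)).tail (Or.inl ⟨n, m, rfl, rfl, ?_⟩)
          simp only [h2]; simpa [endpt] using h3
    exact key _ _ (Γ.connected _ _) l b m c rfl rfl

end ColoredGraph

namespace GraphClass

variable {S : Type u}

/-- The involution of `Σ` that inverts the orientations of all edges. -/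
def star (σ : GraphClass S) : GraphClass S where
  glue x y := σ.glue (x.1, !x.2) (y.1, !y.2)
  symm h := σ.symm h
  trans h h' := σ.trans h h'
  flip h := σ.flip h
  regular s b h := σ.regular s (!b) h
  finite := by
    refine σ.finite.subset fun s hs => ?_
    simpa using σ.flip hs
  nonempty := by
    obtain ⟨s, hs⟩ := σ.nonempty
    exact ⟨s, σ.flip hs⟩
  connected x y hx hy := by
    have h := σ.connected _ _ hx hy
    have := Relation.ReflTransGen.lift (p := fun x y : S × Bool =>
      σ.glue (x.1, !x.2) (y.1, !y.2) ∨ y = (x.1, !x.2))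
      (fun x : S × Bool => (x.1, !x.2)) ?_ _ _ h
    · simpa [Function.onFun] using this
    · rintro a b (h | rfl)
      · left; simpa using h
      · right; simp

/-- The colours of the edges. -/
def colors (σ : GraphClass S) : Set S := {s | σ.glue (s, false) (s, false)}

theorem mem_colors_star {σ : GraphClass S} {s : S} : s ∈ σ.star.colors ↔ s ∈ σ.colors :=
  ⟨fun h => σ.flip (s := s) (b := true) h, fun h => σ.flip (s := s) (b := false) h⟩

end GraphClass

namespace ColoredGraph

variable {S : Type u}

theorem exists_endpt (Γ : ColoredGraph S) (p : Γ.Vtx) : ∃ l b, Γ.endpt l b = p := by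
  obtain ⟨l₀⟩ := Γ.nonempty_edge
  induction Γ.connected (Γ.src l₀) p with
  | refl => exact ⟨l₀, false, rfl⟩
  | tail _ h _ =>
    obtain ⟨n, ⟨-, h⟩ | ⟨h, -⟩⟩ := h
    · exact ⟨n, true, h⟩
    · exact ⟨n, false, h⟩

/-- Two coloured graphs have the same class if and only if they are isomorphic. -/
theorem toClass_eq_iff (Γ Γ' : ColoredGraph S) :
    Γ.toClass = Γ'.toClass ↔ Nonempty (Γ.Iso Γ') := by
  classical
  constructor
  · intro h
    have hg : ∀ x y, Γ.toClass.glue x y ↔ Γ'.toClass.glue x y := fun x y => by rw [h]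
    have he : ∀ l, ∃ l', Γ'.color l' = Γ.color l := fun l => by
      obtain ⟨l', -, h, -⟩ := (hg (Γ.color l, false) (Γ.color l, false)).1 ⟨l, l, rfl, rfl, rfl⟩
      exact ⟨l', h⟩
    have he' : ∀ l', ∃ l, Γ.color l = Γ'.color l' := fun l' => by
      obtain ⟨l, -, h, -⟩ :=
        (hg (Γ'.color l', false) (Γ'.color l', false)).2 ⟨l', l', rfl, rfl, rfl⟩
      exact ⟨l, h⟩
    choose e he using he
    choose e' he' using he'
    have hee : ∀ l l' b c, Γ.endpt l b = Γ.endpt l' c ↔ Γ'.endpt (e l) b = Γ'.endpt (e l') c := by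
      intro l l' b c
      constructor
      · intro h
        obtain ⟨m, m', h1, h2, h3⟩ := (hg (Γ.color l, b) (Γ.color l', c)).1 ⟨l, l', rfl, rfl, h⟩
        obtain rfl := Γ'.color_injective (h1.trans (he l).symm)
        obtain rfl := Γ'.color_injective (h2.trans (he l').symm)
        exact h3
      · intro h
        obtain ⟨m, m', h1, h2, h3⟩ :=
          (hg (Γ.color l, b) (Γ.color l', c)).2 ⟨e l, e l', he l, he l', h⟩
        obtain rfl := Γ.color_injective h1
        obtain rfl := Γ.color_injective h2
        exact h3
    choose f b hf using Γ.exists_endpt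
    have hinv : ∀ l', e (e' l') = l' := fun l' => Γ'.color_injective ((he _).trans (he' _))
    have hbij : Function.Bijective fun p => Γ'.endpt (e (f p)) (b p) := by
      refine ⟨fun p q hpq => ?_, fun p' => ?_⟩
      · have := (hee _ _ _ _).2 hpq
        rwa [hf, hf] at this
      · obtain ⟨l', c, rfl⟩ := Γ'.exists_endpt p'
        refine ⟨Γ.endpt (e' l') c, ?_⟩
        have := (hee (f (Γ.endpt (e' l') c)) (e' l') (b (Γ.endpt (e' l') c)) c).1 (hf _)
        rwa [hinv] at this
    refine ⟨{
      vtx := Equiv.ofBijective _ hbij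
      edge := ⟨e, e', fun l => Γ.color_injective ((he' _).trans (he _)), hinv⟩
      color_edge := he
      src_edge := fun l => ?_
      tgt_edge := fun l => ?_ }⟩
    · exact ((hee _ l _ false).1 (hf (Γ.src l))).symm
    · exact ((hee _ l _ true).1 (hf (Γ.tgt l))).symm
  · rintro ⟨φ⟩
    have hend : ∀ l b, Γ'.endpt (φ.edge l) b = φ.vtx (Γ.endpt l b) := fun l b => by
      cases b
      · exact φ.src_edge l
      · exact φ.tgt_edge l
    ext x y
    constructor
    · rintro ⟨l, m, h1, h2, h3⟩
      exact ⟨φ.edge l, φ.edge m, (φ.color_edge l).trans h1, (φ.color_edge m).trans h2, by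
        rw [hend, hend, h3]⟩
    · rintro ⟨l', m', h1, h2, h3⟩
      obtain ⟨l, rfl⟩ := φ.edge.surjective l'
      obtain ⟨m, rfl⟩ := φ.edge.surjective m'
      rw [hend, hend] at h3
      exact ⟨l, m, (φ.color_edge l).symm.trans h1, (φ.color_edge m).symm.trans h2,
        φ.vtx.injective h3⟩

/-- Every class is the class of a coloured graph. -/
theorem toClass_surjective (σ : GraphClass S) : ∃ Γ : ColoredGraph S, Γ.toClass = σ := by
  let V : Type u := {x : S × Bool // σ.glue x x}
  let r : Setoid V := ⟨fun x y => σ.glue x.1 y.1, fun x => x.2, σ.symm, σ.trans⟩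
  let p : V → Quotient r := Quotient.mk r
  have hp : ∀ x y, p x = p y ↔ σ.glue x.1 y.1 := fun x y => Quotient.eq (r := r)
  let src : σ.colors → Quotient r := fun s => p ⟨(s.1, false), s.2⟩
  let tgt : σ.colors → Quotient r := fun s => p ⟨(s.1, true), σ.flip s.2⟩
  have hcol : ∀ (s : S) (b : Bool), σ.glue (s, b) (s, b) → s ∈ σ.colors := by
    intro s b h
    cases b
    · exact h
    · exact σ.flip h
  let R : Quotient r → Quotient r → Prop :=
    fun p q => ∃ l, (src l = p ∧ tgt l = q) ∨ (src l = q ∧ tgt l = p)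
  have key : ∀ x y (hx : σ.glue x x),
      Relation.ReflTransGen (fun x y => σ.glue x y ∨ y = (x.1, !x.2)) x y →
      ∃ hy : σ.glue y y, Relation.ReflTransGen R (p ⟨x, hx⟩) (p ⟨y, hy⟩) := by
    intro x y hx h
    induction h with
    | refl => exact ⟨hx, Relation.ReflTransGen.refl⟩
    | tail _ h ih =>
      rename_i y z _
      obtain ⟨hy, ih⟩ := ih
      rcases h with h | rfl
      · refine ⟨σ.trans (σ.symm h) h, ?_⟩
        rwa [← (hp ⟨y, hy⟩ ⟨z, σ.trans (σ.symm h) h⟩).2 h]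
      · obtain ⟨s, b⟩ := y
        refine ⟨σ.flip hy, ih.tail ⟨⟨s, hcol s b hy⟩, ?_⟩⟩
        cases b
        · exact Or.inl ⟨rfl, rfl⟩
        · exact Or.inr ⟨rfl, rfl⟩
  refine ⟨{
    Vtx := Quotient r
    Edge := σ.colors
    finite_edge := σ.finite
    nonempty_edge := by
      obtain ⟨s, hs⟩ := σ.nonempty
      exact ⟨⟨s, hs⟩⟩
    color := Subtype.val
    color_injective := Subtype.val_injective
    src := src
    tgt := tgt
    src_ne_tgt := fun l h => σ.regular _ _ ((hp _ _).1 h)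
    connected := fun x y => by
      induction x using Quotient.inductionOn with | _ x => ?_
      induction y using Quotient.inductionOn with | _ y => ?_
      exact (key x.1 y.1 x.2 (σ.connected _ _ x.2 y.2)).2 }, ?_⟩
  ext ⟨s, b⟩ ⟨t, c⟩
  constructor
  · rintro ⟨l, m, h1, h2, h3⟩
    dsimp at h1 h2
    subst h1 h2
    cases b <;> cases c <;> exact (hp _ _).1 h3
  · intro h
    have hs := hcol s b (σ.trans h (σ.symm h))
    have ht := hcol t c (σ.trans (σ.symm h) h)
    refine ⟨⟨s, hs⟩, ⟨t, ht⟩, rfl, rfl, ?_⟩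
    cases b <;> cases c <;> exact (hp _ _).2 h

end ColoredGraph

/-! ### Connected film surfaces -/

/-- A division of a cyclically ordered set into two nonempty parts `A`, `Aᶜ` that is compatible with
the cyclic order: the two parts do not interleave, i.e. they are arcs. -/
structure IsDivision {V : Type*} [CircularOrder V] (A : Set V) : Prop where
  nonempty : A.Nonempty
  compl_nonempty : Aᶜ.Nonempty
  not_interleave : ∀ a ∈ A, ∀ b ∈ Aᶜ, ∀ a' ∈ A, ∀ b' ∈ Aᶜ, ¬ (sbtw a b a' ∧ sbtw a' b' a)

/-- A connected coloured almost cyclic complex, described by its cells.  It is glued from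
finitely many oriented disks of different colours along the graph `Δ` with vertices `Vert`, edges
`Edge` and incidence `ends`.  The boundary circle of a disk is divided by the preimages of the
vertices of `Δ` into sides, which are oriented by the disk: the side `f` of the disk `disk f` is
mapped by the gluing map homeomorphically onto the edge `edge f`, and goes from `tail f`
to `head f`. -/
structure AlmostCyclicComplex (S : Type u) where
  Vert : Type
  Edge : Type u
  Disk : Type u
  Side : Type u
  [finite_vert : Finite Vert]
  [finite_edge : Finite Edge]
  [finite_disk : Finite Disk]
  [finite_side : Finite Side]
  /-- the cyclic order on the vertices -/
  [cyclicOrder : CircularOrder Vert]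
  color : Disk → S
  color_injective : Function.Injective color
  ends : Edge → Sym2 Vert
  disk : Side → Disk
  edge : Side → Edge
  tail : Side → Vert
  head : Side → Vert
  ends_edge : ∀ f, ends (edge f) = s(tail f, head f)
  /-- the graph `Δ` has no loops -/
  tail_ne_head : ∀ f, tail f ≠ head f
  /-- after every side comes a side -/
  exists_next : ∀ f, ∃ g, disk g = disk f ∧ tail g = head f
  /-- the gluing map is injective on the boundary circle of a disk: on the vertices ... -/
  tail_injective : ∀ f g, disk f = disk g → tail f = tail g → f = g
  /-- ... and on the sides -/
  edge_injective : ∀ f g, disk f = disk g → edge f = edge g → f = g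
  disk_surjective : Function.Surjective disk
  /-- the gluing map is surjective: on the edges of `Δ` ... -/
  edge_surjective : Function.Surjective edge
  /-- ... and on the vertices of `Δ` -/
  tail_surjective : Function.Surjective tail
  /-- the cyclic order is compatible with the orientations of the disks: a side joins a vertex of
  its disk to the next vertex of this disk in the cyclic order -/
  compatible : ∀ f g, disk g = disk f → ¬ sbtw (tail f) (tail g) (head f)
  connected : ∀ p q, Relation.ReflTransGen (fun p q => ∃ e, ends e = s(p, q)) p q

namespace AlmostCyclicComplex

attribute [instance] finite_vert finite_edge finite_disk finite_side cyclicOrder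

variable {S : Type u} (Ω : AlmostCyclicComplex S)

/-- The edge `e` joins the two parts of the division of the vertices into `A` and `Aᶜ`. -/
def Crosses (A : Set Ω.Vert) (e : Ω.Edge) : Prop := ∃ a ∈ A, ∃ b ∈ Aᶜ, Ω.ends e = s(a, b)

/-- There is a graph-cut that realizes the division of the vertices into the arcs `A` and `Aᶜ`.
Up to isotopy, there is just one candidate for it: its vertices are interior points of the edges of
`Ω` that join `A` and `Aᶜ`, one point on each, and its edges are segments in the disks that have
vertices in both parts, one segment in each such disk; this segment joins the side of the disk that
goes from `A` to `Aᶜ` with the side that goes back.  A graph-cut has to be connected, and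
if this graph is connected, it cuts the connected complex `Ω` into two connected components. -/
def HasGraphCut (A : Set Ω.Vert) : Prop :=
  ∀ e e', Ω.Crosses A e → Ω.Crosses A e' →
    Relation.ReflTransGen (fun e e' => Ω.Crosses A e' ∧
      ∃ f f', Ω.disk f = Ω.disk f' ∧ Ω.edge f = e ∧ Ω.edge f' = e') e e'

end AlmostCyclicComplex

/-- A connected film surface, i.e. a connected coloured cyclic complex. -/
structure ConnectedFilm (S : Type u) extends AlmostCyclicComplex S where
  hasGraphCut : ∀ A : Set Vert, IsDivision A → toAlmostCyclicComplex.HasGraphCut A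

/-- Isomorphisms of connected film surfaces: homeomorphisms (up to isotopy) that preserve the cyclic
order and the orientations and colours of the disks. -/
structure ConnectedFilm.Iso {S : Type u} (Ω Ω' : ConnectedFilm S) where
  vert : Ω.Vert ≃ Ω'.Vert
  edge : Ω.Edge ≃ Ω'.Edge
  disk : Ω.Disk ≃ Ω'.Disk
  side : Ω.Side ≃ Ω'.Side
  btw_vert : ∀ p q r, btw (vert p) (vert q) (vert r) ↔ btw p q r
  color_disk : ∀ d, Ω'.color (disk d) = Ω.color d
  disk_side : ∀ f, Ω'.disk (side f) = disk (Ω.disk f)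
  edge_side : ∀ f, Ω'.edge (side f) = edge (Ω.edge f)
  tail_side : ∀ f, Ω'.tail (side f) = vert (Ω.tail f)
  head_side : ∀ f, Ω'.head (side f) = vert (Ω.head f)

/-! ### Vertex graphs -/

section CircularOrder

variable {V : Type*} [CircularOrder V]

theorem sbtw_of_ne {a b c : V} (h : ¬ sbtw c b a) (hab : a ≠ b) (hbc : b ≠ c) (hca : c ≠ a) :
    sbtw a b c := by
  rw [sbtw_iff_not_btw]
  intro h'
  rw [sbtw_iff_not_btw, not_not] at h
  rcases btw_antisymm h h' with h | h | h
  · exact hab h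
  · exact hbc h
  · exact hca h

theorem SBtw.sbtw.ne_left {a b c : V} (h : sbtw a b c) : a ≠ b := by
  rintro rfl; exact sbtw_irrefl_left h

theorem SBtw.sbtw.ne_right {a b c : V} (h : sbtw a b c) : b ≠ c := by
  rintro rfl; exact sbtw_irrefl_right h

theorem SBtw.sbtw.ne_left_right {a b c : V} (h : sbtw a b c) : c ≠ a := by
  rintro rfl; exact sbtw_irrefl_left_right h

theorem sbtw_of_sbtw_of_sbtw {x a b c : V} (h : sbtw x a b) (h' : sbtw x b c) : sbtw a b c :=
  (h'.cyclic_left.trans_right (h.cyclic_left.cyclic_left.cyclic_left.cyclic_left.cyclic_left)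
    ).cyclic_left.cyclic_left

theorem IsDivision.compl {A : Set V} (hA : IsDivision A) : IsDivision Aᶜ where
  nonempty := hA.compl_nonempty
  compl_nonempty := by simpa using hA.nonempty
  not_interleave a ha b hb a' ha' b' hb' h := by
    rw [compl_compl] at hb hb'
    exact hA.not_interleave b hb a' ha' b' hb' a ha
      ⟨sbtw_of_sbtw_of_sbtw h.1 h.2.cyclic_right, sbtw_of_sbtw_of_sbtw h.2 h.1.cyclic_right⟩

theorem isDivision_singleton (p : V) (h : ∃ q, q ≠ p) : IsDivision {p} where
  nonempty := ⟨p, rfl⟩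
  compl_nonempty := h
  not_interleave := by
    rintro a rfl b hb a' rfl b' hb' h
    exact sbtw_irrefl_left_right h.1

end CircularOrder

namespace AlmostCyclicComplex

variable {S : Type u} (Ω : AlmostCyclicComplex S)

theorem head_injective (f g : Ω.Side) (h : Ω.disk f = Ω.disk g) (h' : Ω.head f = Ω.head g) :
    f = g := by
  by_contra hne
  have h1 : Ω.tail f ≠ Ω.tail g := fun h1 => hne (Ω.tail_injective f g h h1)
  have h2 := sbtw_of_ne (Ω.compatible f g h.symm) (h' ▸ (Ω.tail_ne_head g).symm) h1.symm
    (Ω.tail_ne_head f)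
  exact Ω.compatible g f h (h' ▸ h2.cyclic_left)

theorem exists_prev (f : Ω.Side) : ∃ g, Ω.disk g = Ω.disk f ∧ Ω.head g = Ω.tail f := by
  choose n hn hn' using Ω.exists_next
  have hinj : Function.Injective n := fun f g h => Ω.head_injective f g
    (by rw [← hn f, ← hn g, h]) (by rw [← hn' f, ← hn' g, h])
  obtain ⟨g, rfl⟩ := Finite.surjective_of_injective hinj f
  exact ⟨g, (hn g).symm, (hn' g).symm⟩

/-- The side of the same disk that comes before the side `f`. -/
noncomputable def prev (f : Ω.Side) : Ω.Side := (Ω.exists_prev f).choose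

theorem disk_prev (f : Ω.Side) : Ω.disk (Ω.prev f) = Ω.disk f := (Ω.exists_prev f).choose_spec.1

theorem head_prev (f : Ω.Side) : Ω.head (Ω.prev f) = Ω.tail f := (Ω.exists_prev f).choose_spec.2

theorem eq_prev {f g : Ω.Side} (h : Ω.disk g = Ω.disk f) (h' : Ω.head g = Ω.tail f) :
    g = Ω.prev f :=
  Ω.head_injective _ _ (h.trans (Ω.disk_prev f).symm) (h'.trans (Ω.head_prev f).symm)

theorem mem_ends_tail (f : Ω.Side) : Ω.tail f ∈ Ω.ends (Ω.edge f) := by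
  rw [Ω.ends_edge]; exact Sym2.mem_mk_left _ _

theorem mem_ends_head (f : Ω.Side) : Ω.head f ∈ Ω.ends (Ω.edge f) := by
  rw [Ω.ends_edge]; exact Sym2.mem_mk_right _ _

theorem eq_or_eq_of_mem_ends {f : Ω.Side} {q : Ω.Vert} (h : q ∈ Ω.ends (Ω.edge f)) :
    q = Ω.tail f ∨ q = Ω.head f := by
  rw [Ω.ends_edge] at h; exact Sym2.mem_iff.1 h

theorem exists_ne (q : Ω.Vert) : ∃ p, p ≠ q := by
  obtain ⟨f, rfl⟩ := Ω.tail_surjective q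
  exact ⟨_, (Ω.tail_ne_head f).symm⟩

theorem crosses_edge {A : Set Ω.Vert} {f : Ω.Side} :
    Ω.Crosses A (Ω.edge f) ↔ (Ω.tail f ∈ A ↔ Ω.head f ∉ A) := by
  constructor
  · rintro ⟨a, ha, b, hb, h⟩
    rw [Ω.ends_edge, Sym2.eq_iff] at h
    rcases h with ⟨h1, h2⟩ | ⟨h1, h2⟩ <;> rw [h1, h2]
    · exact ⟨fun _ => hb, fun _ => ha⟩
    · exact ⟨fun h => (hb h).elim, fun h => (h ha).elim⟩
  · intro h
    by_cases h1 : Ω.tail f ∈ A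
    · exact ⟨_, h1, _, h.1 h1, Ω.ends_edge f⟩
    · exact ⟨_, not_not.1 fun h2 => h1 (h.2 h2), _, h1, (Ω.ends_edge f).trans Sym2.eq_swap⟩

theorem crosses_singleton {q : Ω.Vert} {e : Ω.Edge} : Ω.Crosses {q} e ↔ q ∈ Ω.ends e := by
  obtain ⟨f, rfl⟩ := Ω.edge_surjective e
  rw [crosses_edge, Ω.ends_edge, Sym2.mem_iff]
  have := Ω.tail_ne_head f
  constructor
  · intro h
    by_cases h1 : Ω.tail f = q
    · exact Or.inl h1.symm
    · right
      by_contra h2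
      exact h1 (h.2 fun h3 => h2 h3.symm)
  · rintro (rfl | rfl)
    · exact ⟨fun _ h => this h.symm, fun _ => rfl⟩
    · exact ⟨fun h => (this h).elim, fun h => (h rfl).elim⟩

end AlmostCyclicComplex

namespace ConnectedFilm

variable {S : Type u} (Ω : ConnectedFilm S)

/-- The vertex graph of the vertex `q`: the boundary of a small neighbourhood of `q`.  Its
vertices lie on the edges of `Ω` at `q`; its edges lie in the disks at `q`, or in other words
correspond to the sides that leave `q`, and have the colours of these disks.  They are oriented as
boundary arcs of the parts of the disks outside the neighbourhood, i.e. from the side that arrives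
at `q` to the side that leaves `q`. -/
noncomputable def vertexGraph (q : Ω.Vert) : ColoredGraph S where
  Vtx := {e : Ω.Edge // q ∈ Ω.ends e}
  Edge := {f : Ω.Side // Ω.tail f = q}
  finite_edge := inferInstance
  nonempty_edge := by
    obtain ⟨f, hf⟩ := Ω.tail_surjective q
    exact ⟨⟨f, hf⟩⟩
  color f := Ω.color (Ω.disk f.1)
  color_injective f g h :=
    Subtype.ext (Ω.tail_injective _ _ (Ω.color_injective h) (f.2.trans g.2.symm))
  src f := ⟨Ω.edge (Ω.prev f.1), by
    have := Ω.mem_ends_head (Ω.prev f.1)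
    rwa [Ω.head_prev, f.2] at this⟩
  tgt f := ⟨Ω.edge f.1, by
    have := Ω.mem_ends_tail f.1
    rwa [f.2] at this⟩
  src_ne_tgt f h := by
    have h1 := Ω.edge_injective _ _ (Ω.disk_prev f.1) (congrArg Subtype.val h)
    have h2 := Ω.head_prev f.1
    rw [h1] at h2
    exact Ω.tail_ne_head _ h2.symm
  connected := by
    have key : ∀ e e', Relation.ReflTransGen (fun e e' => Ω.Crosses {q} e' ∧
        ∃ f f', Ω.disk f = Ω.disk f' ∧ Ω.edge f = e ∧ Ω.edge f' = e') e e' →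
        ∀ (he : q ∈ Ω.ends e), ∃ he' : q ∈ Ω.ends e', Relation.ReflTransGen
          (fun p p' : {e : Ω.Edge // q ∈ Ω.ends e} => ∃ l : {f : Ω.Side // Ω.tail f = q},
            (Ω.edge (Ω.prev l.1) = p.1 ∧ Ω.edge l.1 = p'.1) ∨
            (Ω.edge (Ω.prev l.1) = p'.1 ∧ Ω.edge l.1 = p.1)) ⟨e, he⟩ ⟨e', he'⟩ := by
      intro e e' h he
      induction h with
      | refl => exact ⟨he, Relation.ReflTransGen.refl⟩
      | tail _ h ih =>
        obtain ⟨hb, ih⟩ := ih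
        obtain ⟨hc, f, f', hd, rfl, rfl⟩ := h
        rw [AlmostCyclicComplex.crosses_singleton] at hc
        refine ⟨hc, ?_⟩
        rcases Ω.eq_or_eq_of_mem_ends hb with h1 | h1 <;>
          rcases Ω.eq_or_eq_of_mem_ends hc with h2 | h2
        · obtain rfl := Ω.tail_injective _ _ hd (h1.symm.trans h2)
          exact ih
        · obtain rfl := Ω.eq_prev hd.symm (h2.symm.trans h1)
          exact ih.tail ⟨⟨f, h1.symm⟩, Or.inr ⟨rfl, rfl⟩⟩
        · obtain rfl := Ω.eq_prev hd (h1.symm.trans h2)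
          exact ih.tail ⟨⟨f', h2.symm⟩, Or.inl ⟨rfl, rfl⟩⟩
        · obtain rfl := Ω.head_injective _ _ hd (h1.symm.trans h2)
          exact ih
    rintro ⟨e, he⟩ ⟨e', he'⟩
    have := (key e e' (Ω.hasGraphCut {q} (isDivision_singleton q (Ω.exists_ne q)) e e'
      (Ω.crosses_singleton.2 he) (Ω.crosses_singleton.2 he')) he).2
    simpa only [Subtype.ext_iff] using this

/-- The class `σ_q` of the vertex graph of `q`. -/
noncomputable def vertexClass (q : Ω.Vert) : GraphClass S := (Ω.vertexGraph q).toClass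

/-- The side `f` of the disk of colour `s` leaves (`b = true`) or enters (`b = false`) the
vertex `q`. -/
def IsEnd (q : Ω.Vert) (s : S) (b : Bool) (f : Ω.Side) : Prop :=
  Ω.color (Ω.disk f) = s ∧ (if b then Ω.tail f else Ω.head f) = q

theorem vertexClass_glue (q : Ω.Vert) (x y : S × Bool) : (Ω.vertexClass q).glue x y ↔
    ∃ f g, Ω.IsEnd q x.1 x.2 f ∧ Ω.IsEnd q y.1 y.2 g ∧ Ω.edge f = Ω.edge g := by
  have h1 : ∀ s b e, (∃ f, Ω.IsEnd q s b f ∧ Ω.edge f = e) ↔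
      ∃ l, (Ω.vertexGraph q).color l = s ∧ ((Ω.vertexGraph q).endpt l b).1 = e := by
    intro s b e
    cases b
    · constructor
      · rintro ⟨f, ⟨hs, hq⟩, rfl⟩
        obtain ⟨g, hg, hg'⟩ := Ω.exists_next f
        simp only [Bool.false_eq_true, if_false] at hq
        refine ⟨⟨g, hg'.trans hq⟩, ?_, ?_⟩
        · change Ω.color (Ω.disk g) = s
          rw [hg, hs]
        · change Ω.edge (Ω.prev g) = _
          rw [← Ω.eq_prev hg.symm hg'.symm]
      · rintro ⟨⟨g, hg⟩, hs, rfl⟩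
        refine ⟨Ω.prev g, ⟨?_, ?_⟩, rfl⟩
        · rw [Ω.disk_prev]; exact hs
        · simpa [Ω.head_prev] using hg
    · constructor
      · rintro ⟨f, ⟨hs, hq⟩, rfl⟩
        exact ⟨⟨f, hq⟩, hs, rfl⟩
      · rintro ⟨⟨g, hg⟩, hs, rfl⟩
        exact ⟨g, ⟨hs, hg⟩, rfl⟩
  constructor
  · rintro ⟨l, m, hl, hm, h⟩
    obtain ⟨f, hf, hf'⟩ := (h1 x.1 x.2 _).2 ⟨l, hl, rfl⟩
    obtain ⟨g, hg, hg'⟩ := (h1 y.1 y.2 _).2 ⟨m, hm, rfl⟩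
    exact ⟨f, g, hf, hg, by rw [hf', hg', h]⟩
  · rintro ⟨f, g, hf, hg, h⟩
    obtain ⟨l, hl, hl'⟩ := (h1 x.1 x.2 _).1 ⟨f, hf, rfl⟩
    obtain ⟨m, hm, hm'⟩ := (h1 y.1 y.2 _).1 ⟨g, hg, rfl⟩
    exact ⟨l, m, hl, hm, Subtype.ext (by rw [hl', hm', h])⟩

theorem vertexClass_iso {Ω Ω' : ConnectedFilm S} (φ : Ω.Iso Ω') (q : Ω.Vert) :
    Ω'.vertexClass (φ.vert q) = Ω.vertexClass q := by
  have hend : ∀ s b f, Ω'.IsEnd (φ.vert q) s b (φ.side f) ↔ Ω.IsEnd q s b f := by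
    intro s b f
    unfold IsEnd
    rw [φ.disk_side, φ.color_disk]
    cases b <;> simp [φ.tail_side, φ.head_side]
  ext x y
  rw [vertexClass_glue, vertexClass_glue]
  constructor
  · rintro ⟨f', g', hf, hg, h⟩
    obtain ⟨f, rfl⟩ := φ.side.surjective f'
    obtain ⟨g, rfl⟩ := φ.side.surjective g'
    rw [φ.edge_side, φ.edge_side] at h
    exact ⟨f, g, (hend _ _ _).1 hf, (hend _ _ _).1 hg, φ.edge.injective h⟩
  · rintro ⟨f, g, hf, hg, h⟩
    exact ⟨φ.side f, φ.side g, (hend _ _ _).2 hf, (hend _ _ _).2 hg, by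
      rw [φ.edge_side, φ.edge_side, h]⟩

/-- If a film surface has only two vertices, then their graphs differ by the orientation. -/
theorem vertexClass_eq_star {q₁ q₂ : Ω.Vert} (hne : q₁ ≠ q₂) (h : ∀ q, q = q₁ ∨ q = q₂) :
    Ω.vertexClass q₂ = (Ω.vertexClass q₁).star := by
  have hend : ∀ s b f, Ω.IsEnd q₂ s b f ↔ Ω.IsEnd q₁ s (!b) f := by
    intro s b f
    unfold IsEnd
    have := Ω.tail_ne_head f
    rcases h (Ω.tail f) with h1 | h1 <;> rcases h (Ω.head f) with h2 | h2
    · exact (this (h1.trans h2.symm)).elim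
    · cases b <;> simp [h1, h2, hne, hne.symm]
    · cases b <;> simp [h1, h2, hne, hne.symm]
    · exact (this (h1.trans h2.symm)).elim
  ext x y
  change _ ↔ (Ω.vertexClass q₁).glue _ _
  rw [vertexClass_glue, vertexClass_glue]
  simp only [hend]

end ConnectedFilm

/-! ### Cuts -/

section Contract

variable {V : Type} (A : Set V)

open Classical in
/-- The contraction of the complement of `A` to one point `none`. -/
noncomputable def contract (p : V) : Option A := if h : p ∈ A then some ⟨p, h⟩ else none

variable {A}

theorem contract_of_mem {p : V} (h : p ∈ A) : contract A p = some ⟨p, h⟩ := dif_pos h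

theorem contract_of_notMem {p : V} (h : p ∉ A) : contract A p = none := dif_neg h

theorem contract_eq_contract {p q : V} :
    contract A p = contract A q ↔ p = q ∨ (p ∉ A ∧ q ∉ A) := by
  by_cases hp : p ∈ A <;> by_cases hq : q ∈ A <;> simp [contract, hp, hq]
  · rintro rfl; exact hq hp
  · rintro rfl; exact hp hq

variable [CircularOrder V]

theorem contract_surjective (hA : IsDivision A) : Function.Surjective (contract A) := by
  rintro (_ | ⟨p, hp⟩)
  · obtain ⟨b, hb⟩ := hA.compl_nonempty
    exact ⟨b, contract_of_notMem hb⟩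
  · exact ⟨p, contract_of_mem hp⟩

/-- The embedding that represents the point `none` by some element of the complement of `A`. -/
noncomputable def uncontract (hA : IsDivision A) (o : Option A) : V :=
  o.elim hA.compl_nonempty.choose Subtype.val

theorem contract_uncontract (hA : IsDivision A) (o : Option A) :
    contract A (uncontract hA o) = o := by
  cases o with
  | none => exact contract_of_notMem hA.compl_nonempty.choose_spec
  | some p => exact contract_of_mem p.2

/-- The cyclic order on the points of the arc `A` and the contracted complementary arc; see
`sbtw_contract`. -/
noncomputable abbrev contractOrder (hA : IsDivision A) : CircularOrder (Option A) where
  btw a b c := btw (uncontract hA a) (uncontract hA b) (uncontract hA c)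
  sbtw a b c := sbtw (uncontract hA a) (uncontract hA b) (uncontract hA c)
  btw_refl _ := btw_rfl
  btw_cyclic_left h := btw_cyclic_left h
  sbtw_iff_btw_not_btw := sbtw_iff_btw_not_btw
  sbtw_trans_left h h' := sbtw_trans_left h h'
  btw_antisymm {a b c} h h' := by
    have hinj : Function.Injective (uncontract hA) :=
      Function.LeftInverse.injective (contract_uncontract hA)
    simpa only [hinj.eq_iff] using btw_antisymm h h'
  btw_total _ _ _ := btw_total _ _ _

theorem sbtw_of_notMem (hA : IsDivision A) {b b' v w : V} (hb : b ∉ A) (hb' : b' ∉ A)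
    (hv : v ∈ A) (hw : w ∈ A) (h : sbtw b v w) : sbtw b' v w := by
  refine sbtw_of_ne (fun h' => ?_) (fun e => hb' (e ▸ hv)) h.ne_right (fun e => hb' (e ▸ hw))
  exact hA.not_interleave v hv b' hb' w hw b hb ⟨h'.cyclic_left, h.cyclic_right⟩

theorem sbtw_of_contract_eq (hA : IsDivision A) {p q r p' q' r' : V} (h : sbtw p q r)
    (hp : contract A p' = contract A p) (hq : contract A q' = contract A q)
    (hr : contract A r' = contract A r)
    (hpq : contract A p ≠ contract A q) (hqr : contract A q ≠ contract A r)
    (hrp : contract A r ≠ contract A p) : sbtw p' q' r' := by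
  simp only [ne_eq, contract_eq_contract, not_or, not_and_or, not_not] at *
  rcases hp with rfl | ⟨hp', hp⟩
  · rcases hq with rfl | ⟨hq', hq⟩
    · rcases hr with rfl | ⟨hr', hr⟩
      · exact h
      · exact (sbtw_of_notMem hA hr hr' (by tauto) (by tauto) h.cyclic_right).cyclic_left
    · have hr1 : r' = r := by tauto
      subst hr1
      exact (sbtw_of_notMem hA hq hq' (by tauto) (by tauto) h.cyclic_left).cyclic_right
  · have hr1 : r' = r := by tauto
    have hq1 : q' = q := by tauto
    subst hr1 hq1
    exact sbtw_of_notMem hA hp hp' (by tauto) (by tauto) h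

/-- The contraction preserves the cyclic order of any three points with different images. -/
theorem sbtw_contract (hA : IsDivision A) {p q r : V} (hpq : contract A p ≠ contract A q)
    (hqr : contract A q ≠ contract A r) (hrp : contract A r ≠ contract A p) :
    (contractOrder hA).sbtw (contract A p) (contract A q) (contract A r) ↔ sbtw p q r := by
  constructor
  · intro h
    exact sbtw_of_contract_eq hA (p := uncontract hA (contract A p))
      (q := uncontract hA (contract A q)) (r := uncontract hA (contract A r)) h
      (contract_uncontract hA _).symm (contract_uncontract hA _).symm
      (contract_uncontract hA _).symm (by simpa only [contract_uncontract])
      (by simpa only [contract_uncontract]) (by simpa only [contract_uncontract])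
  · intro h
    exact sbtw_of_contract_eq hA h (contract_uncontract hA _) (contract_uncontract hA _)
      (contract_uncontract hA _) hpq hqr hrp

theorem isDivision_preimage_contract (hA : IsDivision A) {A' : Set (Option A)}
    (hA' : @IsDivision _ (contractOrder hA) A') : IsDivision (contract A ⁻¹' A') := by
  let _ := contractOrder hA
  refine ⟨hA'.nonempty.preimage (contract_surjective hA),
    hA'.compl_nonempty.preimage (contract_surjective hA), ?_⟩
  · rintro a ha b hb a' ha' b' hb' ⟨h1, h2⟩
    have n1 : contract A a ≠ contract A b := fun h => hb (by simpa [← h] using ha)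
    have n2 : contract A a ≠ contract A b' := fun h => hb' (by simpa [← h] using ha)
    have n3 : contract A a' ≠ contract A b := fun h => hb (by simpa [← h] using ha')
    have n4 : contract A a' ≠ contract A b' := fun h => hb' (by simpa [← h] using ha')
    by_cases hab : contract A a = contract A a'
    · have h3 : a ∉ A ∧ a' ∉ A := (contract_eq_contract.1 hab).resolve_left h1.ne_left_right.symm
      have m1 : b ∈ A := by
        by_contra h; exact n1 (contract_eq_contract.2 (Or.inr ⟨h3.1, h⟩))
      have m2 : b' ∈ A := by
        by_contra h; exact n2 (contract_eq_contract.2 (Or.inr ⟨h3.1, h⟩))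
      refine hA.compl.not_interleave a h3.1 b (by simpa) a' h3.2 b' (by simpa) ⟨h1, h2⟩
    · refine hA'.not_interleave (contract A a) ha (contract A b) hb (contract A a') ha'
        (contract A b') hb' ⟨?_, ?_⟩
      · exact (sbtw_contract hA n1 n3.symm (Ne.symm hab)).2 h1
      · exact (sbtw_contract hA n4 n2.symm hab).2 h2

end Contract

namespace AlmostCyclicComplex

variable {S : Type u} (Ω : AlmostCyclicComplex S)

/-- A disk with vertices in `A` and in the complement of `A` has a side that enters `A`. -/
theorem exists_enter {A : Set Ω.Vert} {f₀ f₁ : Ω.Side} (h : Ω.disk f₁ = Ω.disk f₀)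
    (h₀ : Ω.tail f₀ ∈ A) (h₁ : Ω.tail f₁ ∉ A) :
    ∃ f, Ω.disk f = Ω.disk f₀ ∧ Ω.tail f ∉ A ∧ Ω.head f ∈ A := by
  let r : Ω.Side → Ω.Side → Prop := fun f g => sbtw (Ω.tail f₀) (Ω.tail g) (Ω.tail f)
  have : IsTrans Ω.Side r := ⟨fun a b c h h' => h'.trans_right h⟩
  have : Std.Irrefl r := ⟨fun a h => sbtw_irrefl_right h⟩
  obtain ⟨f, ⟨hf, hfA⟩, hmin⟩ := (Finite.wellFounded_of_trans_of_irrefl r).has_min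
    {f | Ω.disk f = Ω.disk f₀ ∧ Ω.tail f ∉ A} ⟨f₁, h, h₁⟩
  refine ⟨f, hf, hfA, ?_⟩
  by_contra hh
  obtain ⟨g, hg, hg'⟩ := Ω.exists_next f
  have h2 := hmin g ⟨hg.trans hf, hg' ▸ hh⟩
  have h3 : sbtw (Ω.tail g) (Ω.tail f) (Ω.tail f₀) :=
    sbtw_of_ne h2 (hg' ▸ (Ω.tail_ne_head f).symm) (fun e => hfA (e ▸ h₀))
      (fun e => hh (hg' ▸ e ▸ h₀))
  exact Ω.compatible f f₀ hf.symm (hg' ▸ h3.cyclic_left)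

/-- The part of the cut complex that contains the vertices of the arc `A`: cut `Ω` along the
graph-cut that realizes the division into `A` and its complement, take the component that
contains `A`, and contract the copy of the graph-cut in it to a new vertex `none`.  It consists of
the edges with a vertex in `A` and (parts of) the disks with a vertex in `A`; the sides of these
parts are (parts of) the sides with a vertex in `A`. -/
noncomputable def cut (A : Set Ω.Vert) (hA : IsDivision A) : AlmostCyclicComplex S where
  Vert := Option A
  Edge := {e : Ω.Edge // ∃ a ∈ A, a ∈ Ω.ends e}
  Disk := {d : Ω.Disk // ∃ f, Ω.disk f = d ∧ Ω.tail f ∈ A}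
  Side := {f : Ω.Side // Ω.tail f ∈ A ∨ Ω.head f ∈ A}
  cyclicOrder := contractOrder hA
  color d := Ω.color d.1
  color_injective _ _ h := Subtype.ext (Ω.color_injective h)
  ends e := (Ω.ends e.1).map (contract A)
  disk f := ⟨Ω.disk f.1, by
    rcases f.2 with h | h
    · exact ⟨f.1, rfl, h⟩
    · obtain ⟨g, hg, hg'⟩ := Ω.exists_next f.1
      exact ⟨g, hg, hg' ▸ h⟩⟩
  edge f := ⟨Ω.edge f.1, by
    rcases f.2 with h | h
    · exact ⟨_, h, Ω.mem_ends_tail _⟩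
    · exact ⟨_, h, Ω.mem_ends_head _⟩⟩
  tail f := contract A (Ω.tail f.1)
  head f := contract A (Ω.head f.1)
  ends_edge f := by simp [Ω.ends_edge]
  tail_ne_head f h := by
    rcases contract_eq_contract.1 h with h | h
    · exact Ω.tail_ne_head _ h
    · exact f.2.elim h.1 h.2
  exists_next f := by
    obtain ⟨g, hg, hg'⟩ := Ω.exists_next f.1
    by_cases h : Ω.head f.1 ∈ A
    · exact ⟨⟨g, Or.inl (hg' ▸ h)⟩, Subtype.ext hg, congrArg _ hg'⟩
    · obtain ⟨k, hk, hk1, hk2⟩ := Ω.exists_enter hg (f.2.resolve_right h) (hg' ▸ h)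
      exact ⟨⟨k, Or.inr hk2⟩, Subtype.ext hk, contract_eq_contract.2 (Or.inr ⟨hk1, h⟩)⟩
  tail_injective f g h h' := by
    have hd : Ω.disk f.1 = Ω.disk g.1 := congrArg Subtype.val h
    rcases contract_eq_contract.1 h' with h' | ⟨h1, h2⟩
    · exact Subtype.ext (Ω.tail_injective _ _ hd h')
    · by_contra hne
      have hne : f.1 ≠ g.1 := fun h => hne (Subtype.ext h)
      have hf := f.2.resolve_left h1
      have hg := g.2.resolve_left h2
      have ht : Ω.tail f.1 ≠ Ω.tail g.1 := fun h => hne (Ω.tail_injective _ _ hd h)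
      have h3 := (sbtw_of_ne (Ω.compatible f.1 g.1 hd.symm) (fun e => h2 (e ▸ hf)) ht.symm
        (Ω.tail_ne_head _)).cyclic_right
      have h4 := (sbtw_of_ne (Ω.compatible g.1 f.1 hd) (fun e => h1 (e ▸ hg)) ht
        (Ω.tail_ne_head _)).cyclic_right
      exact hA.compl.not_interleave _ h1 _ (by simpa) _ h2 _ (by simpa) ⟨h3, h4⟩
  edge_injective f g h h' := Subtype.ext (Ω.edge_injective _ _ (congrArg Subtype.val h)
    (congrArg Subtype.val h'))
  disk_surjective := by
    rintro ⟨_, f, rfl, hf⟩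
    exact ⟨⟨f, Or.inl hf⟩, rfl⟩
  edge_surjective := by
    rintro ⟨e, a, ha, hae⟩
    obtain ⟨f, rfl⟩ := Ω.edge_surjective e
    refine ⟨⟨f, ?_⟩, rfl⟩
    rcases Ω.eq_or_eq_of_mem_ends hae with rfl | rfl
    · exact Or.inl ha
    · exact Or.inr ha
  tail_surjective := by
    rintro (_ | ⟨a, ha⟩)
    · obtain ⟨b, hb⟩ := hA.compl_nonempty
      obtain ⟨a, ha⟩ := hA.nonempty
      have key : ∀ q, Relation.ReflTransGen (fun p q => ∃ e, Ω.ends e = s(p, q)) a q → q ∉ A →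
          ∃ p q, p ∈ A ∧ q ∉ A ∧ ∃ e, Ω.ends e = s(p, q) := by
        intro q h hq
        induction h with
        | refl => exact (hq ha).elim
        | tail _ h ih =>
          rename_i p q _
          by_cases h' : p ∈ A
          · exact ⟨p, q, h', hq, h⟩
          · exact ih h'
      obtain ⟨p, q, hp, hq, e, he⟩ := key b (Ω.connected a b) hb
      obtain ⟨f, rfl⟩ := Ω.edge_surjective e
      obtain ⟨g, hg, hg'⟩ := Ω.exists_next f
      rw [Ω.ends_edge, Sym2.eq_iff] at he
      rcases he with ⟨h1, h2⟩ | ⟨h1, h2⟩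
      · obtain ⟨k, -, hk1, hk2⟩ := Ω.exists_enter (A := A) hg (h1 ▸ hp) (by rw [hg', h2]; exact hq)
        exact ⟨⟨k, Or.inr hk2⟩, contract_of_notMem hk1⟩
      · exact ⟨⟨f, Or.inr (h2 ▸ hp)⟩, contract_of_notMem (h1 ▸ hq)⟩
    · obtain ⟨f, rfl⟩ := Ω.tail_surjective a
      exact ⟨⟨f, Or.inl ha⟩, contract_of_mem ha⟩
  compatible f g h h' := by
    have hd : Ω.disk g.1 = Ω.disk f.1 := congrArg Subtype.val h
    let _ := contractOrder hA
    exact Ω.compatible _ _ hd ((sbtw_contract hA h'.ne_left h'.ne_right h'.ne_left_right).1 h')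
  connected := by
    have key : ∀ p q, Relation.ReflTransGen (fun p q => ∃ e, Ω.ends e = s(p, q)) p q →
        Relation.ReflTransGen (fun p q => ∃ e : {e : Ω.Edge // ∃ a ∈ A, a ∈ Ω.ends e},
          (Ω.ends e.1).map (contract A) = s(p, q)) (contract A p) (contract A q) := by
      intro p q h
      induction h with
      | refl => exact Relation.ReflTransGen.refl
      | tail _ h ih =>
        rename_i q r _
        obtain ⟨e, he⟩ := h
        by_cases hq : q ∈ A
        · exact ih.tail ⟨⟨e, q, hq, by simp [he]⟩, by simp [he]⟩
        · by_cases hr : r ∈ A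
          · exact ih.tail ⟨⟨e, r, hr, by simp [he]⟩, by simp [he]⟩
          · rwa [← contract_eq_contract.2 (Or.inr ⟨hq, hr⟩)]
    intro p q
    obtain ⟨p, rfl⟩ := contract_surjective hA p
    obtain ⟨q, rfl⟩ := contract_surjective hA q
    exact key p q (Ω.connected p q)

end AlmostCyclicComplex

namespace ConnectedFilm

variable {S : Type u} (Ω : ConnectedFilm S)

/-- The component, containing the vertices of the arc `A`, of the result of cutting the connected
film surface `Ω` by the graph-cut that divides its vertices into `A` and the complement of `A`. -/
noncomputable def cut (A : Set Ω.Vert) (hA : IsDivision A) : ConnectedFilm S where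
  toAlmostCyclicComplex := Ω.toAlmostCyclicComplex.cut A hA
  hasGraphCut A' hA' := by
    let Ω' := Ω.toAlmostCyclicComplex.cut A hA
    let A'' : Set Ω.Vert := contract A ⁻¹' A'
    have hA'' : IsDivision A'' := isDivision_preimage_contract hA hA'
    have hside : ∀ f : Ω.Side, Ω.Crosses A'' (Ω.edge f) → Ω.tail f ∈ A ∨ Ω.head f ∈ A := by
      intro f hf
      rw [AlmostCyclicComplex.crosses_edge] at hf
      by_contra h
      rw [not_or] at h
      have : contract A (Ω.tail f) = contract A (Ω.head f) := contract_eq_contract.2 (Or.inr h)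
      change contract A _ ∈ A' ↔ contract A _ ∉ A' at hf
      rw [this] at hf
      exact iff_not_self hf
    have hcross : ∀ e : Ω'.Edge, Ω'.Crosses A' e ↔ Ω.Crosses A'' e.1 := by
      intro e
      obtain ⟨f, rfl⟩ := Ω'.edge_surjective e
      rw [AlmostCyclicComplex.crosses_edge]
      exact (Ω.crosses_edge (A := A'') (f := f.1)).symm
    have key : ∀ e e', Relation.ReflTransGen (fun e e' => Ω.Crosses A'' e' ∧
        ∃ f f', Ω.disk f = Ω.disk f' ∧ Ω.edge f = e ∧ Ω.edge f' = e') e e' →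
        ∀ x x' : Ω'.Edge, x.1 = e → x'.1 = e' → Ω.Crosses A'' e →
          Relation.ReflTransGen (fun e e' => Ω'.Crosses A' e' ∧
            ∃ f f', Ω'.disk f = Ω'.disk f' ∧ Ω'.edge f = e ∧ Ω'.edge f' = e') x x' := by
      intro e e' h
      induction h with
      | refl =>
        intro x x' h1 h2 _
        obtain rfl : x = x' := Subtype.ext (h1.trans h2.symm)
        exact Relation.ReflTransGen.refl
      | tail h' h ih =>
        intro x x' h1 h2 h3
        obtain ⟨hc, f, f', hd, rfl, rfl⟩ := h
        have hcf : Ω.Crosses A'' (Ω.edge f) := by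
          rcases Relation.ReflTransGen.cases_tail h' with h' | ⟨_, _, h', _⟩
          · rwa [h']
          · exact h'
        refine (ih x (Ω'.edge ⟨f, hside f hcf⟩) h1 rfl h3).tail
          ⟨(hcross x').2 (h2 ▸ hc), ⟨f, hside f hcf⟩, ⟨f', hside f' hc⟩, Subtype.ext hd, rfl,
            Subtype.ext h2.symm⟩
    intro e e' he he'
    rw [hcross] at he he'
    exact key _ _ (Ω.hasGraphCut A'' hA'' _ _ he he') e e' rfl rfl he

/-- The vertex of the cut surface that comes from a vertex of `A`. -/
def cutVert (A : Set Ω.Vert) (hA : IsDivision A) (a : A) : (Ω.cut A hA).Vert := some a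

/-- The new vertex of the cut surface, to which the copy of the graph-cut is contracted. -/
def cutPoint (A : Set Ω.Vert) (hA : IsDivision A) : (Ω.cut A hA).Vert := none

/-- The cut does not change the graphs of the old vertices. -/
theorem vertexClass_cutVert (A : Set Ω.Vert) (hA : IsDivision A) (a : A) :
    (Ω.cut A hA).vertexClass (Ω.cutVert A hA a) = Ω.vertexClass a := by
  have h1 : ∀ p, contract A p = some a ↔ p = a := by
    intro p
    rw [← contract_of_mem a.2, contract_eq_contract]
    simp
  have h2 : ∀ s b (f : (Ω.cut A hA).Side),
      (Ω.cut A hA).IsEnd (Ω.cutVert A hA a) s b f ↔ Ω.IsEnd a.1 s b f.1 := by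
    intro s b f
    cases b
    · exact and_congr_right fun _ => h1 _
    · exact and_congr_right fun _ => h1 _
  have h3 : ∀ s b f, Ω.IsEnd a.1 s b f → Ω.tail f ∈ A ∨ Ω.head f ∈ A := by
    rintro s (_ | _) f ⟨-, h⟩
    · right; simp at h; rw [h]; exact a.2
    · left; simp at h; rw [h]; exact a.2
  ext x y
  rw [vertexClass_glue, vertexClass_glue]
  constructor
  · rintro ⟨f, g, hf, hg, h⟩
    exact ⟨f.1, g.1, (h2 _ _ _).1 hf, (h2 _ _ _).1 hg, congrArg Subtype.val h⟩
  · rintro ⟨f, g, hf, hg, h⟩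
    exact ⟨⟨f, h3 _ _ _ hf⟩, ⟨g, h3 _ _ _ hg⟩, (h2 _ _ _).2 hf, (h2 _ _ _).2 hg,
      Subtype.ext h⟩

/-- The graphs of the two new vertices differ by the orientation. -/
theorem vertexClass_cutPoint (A : Set Ω.Vert) (hA : IsDivision A) :
    (Ω.cut Aᶜ hA.compl).vertexClass (Ω.cutPoint Aᶜ hA.compl) =
      ((Ω.cut A hA).vertexClass (Ω.cutPoint A hA)).star := by
  have h1 : ∀ (B : Set Ω.Vert) (hB : IsDivision B) (f : (Ω.cut B hB).Side) s b,
      (Ω.cut B hB).IsEnd (Ω.cutPoint B hB) s b f ↔ Ω.color (Ω.disk f.1) = s ∧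
        (if b then Ω.tail f.1 ∉ B ∧ Ω.head f.1 ∈ B else Ω.head f.1 ∉ B ∧ Ω.tail f.1 ∈ B) := by
    intro B hB f s b
    have h2 : ∀ p, contract B p = none ↔ p ∉ B := by
      intro p
      by_cases hp : p ∈ B <;> simp [contract, hp]
    cases b
    · refine and_congr_right fun _ => ?_
      simp only [Bool.false_eq_true, if_false]
      exact (h2 _).trans ⟨fun h => ⟨h, f.2.resolve_right h⟩, fun h => h.1⟩
    · refine and_congr_right fun _ => ?_
      simp only [if_true]
      exact (h2 _).trans ⟨fun h => ⟨h, f.2.resolve_left h⟩, fun h => h.1⟩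
  have h2 : ∀ (B : Set Ω.Vert) (hB : IsDivision B) x y,
      ((Ω.cut B hB).vertexClass (Ω.cutPoint B hB)).glue x y ↔ ∃ f g : Ω.Side,
        (Ω.color (Ω.disk f) = x.1 ∧
          (if x.2 then Ω.tail f ∉ B ∧ Ω.head f ∈ B else Ω.head f ∉ B ∧ Ω.tail f ∈ B)) ∧
        (Ω.color (Ω.disk g) = y.1 ∧
          (if y.2 then Ω.tail g ∉ B ∧ Ω.head g ∈ B else Ω.head g ∉ B ∧ Ω.tail g ∈ B)) ∧
        Ω.edge f = Ω.edge g := by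
    intro B hB x y
    have h3 : ∀ (b : Bool) (f : Ω.Side), (if b then Ω.tail f ∉ B ∧ Ω.head f ∈ B
        else Ω.head f ∉ B ∧ Ω.tail f ∈ B) → Ω.tail f ∈ B ∨ Ω.head f ∈ B := by
      rintro (_ | _) f h
      · exact Or.inl h.2
      · exact Or.inr h.2
    rw [vertexClass_glue]
    constructor
    · rintro ⟨f, g, hf, hg, h⟩
      exact ⟨f.1, g.1, (h1 _ _ _ _ _).1 hf, (h1 _ _ _ _ _).1 hg, congrArg Subtype.val h⟩
    · rintro ⟨f, g, hf, hg, h⟩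
      exact ⟨⟨f, h3 _ _ hf.2⟩, ⟨g, h3 _ _ hg.2⟩, (h1 _ _ _ _ _).2 hf, (h1 _ _ _ _ _).2 hg,
        Subtype.ext h⟩
  have h4 : ∀ (b : Bool) (f : Ω.Side),
      (if b then Ω.tail f ∉ Aᶜ ∧ Ω.head f ∈ Aᶜ else Ω.head f ∉ Aᶜ ∧ Ω.tail f ∈ Aᶜ) ↔
      (if !b then Ω.tail f ∉ A ∧ Ω.head f ∈ A else Ω.head f ∉ A ∧ Ω.tail f ∈ A) := by
    rintro (_ | _) f
    · simp [and_comm]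
    · simp [and_comm]
  ext x y
  change _ ↔ ((Ω.cut A hA).vertexClass (Ω.cutPoint A hA)).glue _ _
  rw [h2, h2]
  simp only [h4]

end ConnectedFilm

namespace ColoredGraph

variable {S : Type u} (Γ : ColoredGraph S)

theorem finite_vtx : Finite Γ.Vtx := by
  have := Γ.finite_edge
  refine Finite.of_surjective (fun x : Γ.Edge × Bool => Γ.endpt x.1 x.2) fun p => ?_
  obtain ⟨l, b, h⟩ := Γ.exists_endpt p
  exact ⟨(l, b), h⟩

/-- The suspension of a coloured graph: the film surface with two vertices whose edges and disks
are the cones over the vertices and edges of the graph. -/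
noncomputable def suspension : ConnectedFilm S where
  Vert := Bool
  Edge := Γ.Vtx
  Disk := Γ.Edge
  Side := Γ.Edge × Bool
  finite_edge := Γ.finite_vtx
  finite_disk := Γ.finite_edge
  finite_side := have := Γ.finite_edge; inferInstance
  cyclicOrder := LinearOrder.toCircularOrder Bool
  color := Γ.color
  color_injective := Γ.color_injective
  ends _ := s(true, false)
  disk := Prod.fst
  edge f := Γ.endpt f.1 f.2
  tail f := f.2
  head f := !f.2
  ends_edge := by
    rintro ⟨l, _ | _⟩ <;> simp [Sym2.eq_swap]
  tail_ne_head := by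
    rintro ⟨l, _ | _⟩ <;> simp
  exists_next f := ⟨(f.1, !f.2), rfl, rfl⟩
  tail_injective _ _ h h' := Prod.ext h h'
  edge_injective := by
    rintro ⟨l, _ | _⟩ ⟨m, _ | _⟩ h h' <;> obtain rfl : l = m := h
    · rfl
    · exact (Γ.src_ne_tgt l h').elim
    · exact (Γ.src_ne_tgt l h'.symm).elim
    · rfl
  disk_surjective l := ⟨(l, true), rfl⟩
  edge_surjective p := by
    obtain ⟨l, b, h⟩ := Γ.exists_endpt p
    exact ⟨(l, b), h⟩
  tail_surjective b := by
    obtain ⟨l⟩ := Γ.nonempty_edge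
    exact ⟨(l, b), rfl⟩
  compatible := by
    rintro ⟨l, b⟩ ⟨m, c⟩ -
    have : ∀ b c : Bool, ¬ (b < c ∧ (c < !b) ∨ (c < !b) ∧ (!b) < b ∨ (!b) < b ∧ b < c) := by
      decide
    exact this b c
  connected := by
    obtain ⟨l⟩ := Γ.nonempty_edge
    rintro (_ | _) (_ | _)
    · exact Relation.ReflTransGen.refl
    · exact Relation.ReflTransGen.single ⟨Γ.src l, Sym2.eq_swap⟩
    · exact Relation.ReflTransGen.single ⟨Γ.src l, rfl⟩
    · exact Relation.ReflTransGen.refl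
  hasGraphCut A hA e e' he he' := by
    refine Relation.ReflTransGen.mono ?_ _ _ (Γ.connected e e')
    rintro p q ⟨l, ⟨rfl, rfl⟩ | ⟨rfl, rfl⟩⟩
    · exact ⟨he, (l, false), (l, true), rfl, rfl, rfl⟩
    · exact ⟨he, (l, true), (l, false), rfl, rfl, rfl⟩

end ColoredGraph

/-- Every class of coloured graphs is the class of a vertex of a film surface that has only two
vertices. -/
theorem GraphClass.exists_suspension {S : Type u} (σ : GraphClass S) :
    ∃ (Ω : ConnectedFilm S) (q₁ q₂ : Ω.Vert), q₁ ≠ q₂ ∧ (∀ q, q = q₁ ∨ q = q₂) ∧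
      Ω.vertexClass q₁ = σ := by
  obtain ⟨Γ, rfl⟩ := ColoredGraph.toClass_surjective σ
  let q₁ : Γ.suspension.Vert := true
  let q₂ : Γ.suspension.Vert := false
  refine ⟨Γ.suspension, q₁, q₂, Bool.true_eq_false.mp, ?_, ?_⟩
  · rintro (_ | _)
    · exact Or.inr rfl
    · exact Or.inl rfl
  · have hend : ∀ s b (f : Γ.suspension.Side), Γ.suspension.IsEnd q₁ s b f ↔
        Γ.color f.1 = s ∧ f.2 = b := by
      rintro s (_ | _) ⟨l, _ | _⟩ <;> refine and_congr_right fun _ => ?_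
      · exact ⟨fun _ => rfl, fun _ => rfl⟩
      · exact ⟨fun h => Bool.noConfusion h, fun h => Bool.noConfusion h⟩
      · exact ⟨fun h => Bool.noConfusion h, fun h => Bool.noConfusion h⟩
      · exact ⟨fun _ => rfl, fun _ => rfl⟩
    ext x y
    rw [ConnectedFilm.vertexClass_glue]
    constructor
    · rintro ⟨f, g, hf, hg, h⟩
      obtain ⟨h1, h2⟩ := (hend _ _ _).1 hf
      obtain ⟨h3, h4⟩ := (hend _ _ _).1 hg
      exact ⟨f.1, g.1, h1, h3, by rw [← h2, ← h4]; exact h⟩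
    · rintro ⟨l, m, h1, h2, h3⟩
      exact ⟨(l, x.2), (m, y.2), (hend _ _ _).2 ⟨h1, rfl⟩, (hend _ _ _).2 ⟨h2, rfl⟩, h3⟩

/-! ### Film surfaces and Film Topological Field Theories -/

/-- A film surface: the disjoint union of finitely many connected film surfaces. -/
structure FilmSurface (S : Type u) where
  Comp : Type
  [fintype_comp : Fintype Comp]
  comp : Comp → ConnectedFilm S

attribute [instance] FilmSurface.fintype_comp

namespace FilmSurface

variable {S : Type u}

/-- The set `Ω_b` of vertices of a film surface. -/
abbrev Vert (Ω : FilmSurface S) : Type := Σ i, (Ω.comp i).Vert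

/-- The class `σ_q` of the graph of the vertex `q`. -/
noncomputable abbrev vertexClass (Ω : FilmSurface S) (q : Ω.Vert) : GraphClass S :=
  (Ω.comp q.1).vertexClass q.2

/-- Isomorphisms of film surfaces. -/
structure Iso (Ω Ω' : FilmSurface S) where
  comp : Ω.Comp ≃ Ω'.Comp
  iso : ∀ i, (Ω.comp i).Iso (Ω'.comp (comp i))

/-- The action of an isomorphism on the vertices. -/
def Iso.vert {Ω Ω' : FilmSurface S} (φ : Ω.Iso Ω') (q : Ω.Vert) : Ω'.Vert :=
  ⟨φ.comp q.1, (φ.iso q.1).vert q.2⟩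

theorem vertexClass_iso {Ω Ω' : FilmSurface S} (φ : Ω.Iso Ω') (q : Ω.Vert) :
    Ω'.vertexClass (φ.vert q) = Ω.vertexClass q :=
  ConnectedFilm.vertexClass_iso (φ.iso q.1) q.2

/-- The disjoint union of two film surfaces. -/
abbrev disjUnion (Ω' Ω'' : FilmSurface S) : FilmSurface S where
  Comp := Ω'.Comp ⊕ Ω''.Comp
  comp := Sum.elim Ω'.comp Ω''.comp

/-- A vertex of the first part of a disjoint union. -/
abbrev inl {Ω' Ω'' : FilmSurface S} (q : Ω'.Vert) : (Ω'.disjUnion Ω'').Vert := ⟨Sum.inl q.1, q.2⟩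

/-- A vertex of the second part of a disjoint union. -/
abbrev inr {Ω' Ω'' : FilmSurface S} (q : Ω''.Vert) : (Ω'.disjUnion Ω'').Vert := ⟨Sum.inr q.1, q.2⟩

end FilmSurface

/-- A connected film surface as a film surface. -/
abbrev ConnectedFilm.toFilm {S : Type u} (Ω : ConnectedFilm S) : FilmSurface S where
  Comp := Unit
  comp _ := Ω

/-- The result `Ω[γ]` of cutting a connected film surface `Ω` by the graph-cut `γ` that divides the
vertices of `Ω` into the arcs `A` and `Aᶜ`, and contracting both copies of `γ` to points. -/
noncomputable abbrev ConnectedFilm.cutFilm {S : Type u} (Ω : ConnectedFilm S) (A : Set Ω.Vert)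
    (hA : IsDivision A) : FilmSurface S :=
  (Ω.cut A hA).toFilm.disjUnion (Ω.cut Aᶜ hA.compl).toFilm

section FieldTheory

variable {S : Type u} (𝕂 : Type v) [Field 𝕂] (B : GraphClass S → Type w)
  [∀ σ, AddCommGroup (B σ)] [∀ σ, Module 𝕂 (B σ)]

/-- Linear forms on the vector space `V_Ω = ⨂_{q ∈ Ω_b} B_q`, where `B_q = B_{σ_q}`, i.e.
multilinear forms on the family of the spaces `B_q`. -/
abbrev FilmForm (Ω : FilmSurface S) : Type (max v w) :=
  MultilinearMap 𝕂 (fun q : Ω.Vert => B (Ω.vertexClass q)) 𝕂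

variable {B}

/-- For vectors `x_q ∈ B_q` at the vertices of a connected film surface `Ω` and
vectors `y ∈ B_{q₊}`, `z ∈ B_{q₋}` at the two new vertices of the cut surface: the family of vectors
at the vertices of the cut surface that is made of them. -/
noncomputable def cutVectors (Ω : ConnectedFilm S) (A : Set Ω.Vert) (hA : IsDivision A)
    (x : ∀ q : Ω.Vert, B (Ω.vertexClass q))
    (y : B ((Ω.cut A hA).vertexClass (Ω.cutPoint A hA)))
    (z : B ((Ω.cut Aᶜ hA.compl).vertexClass (Ω.cutPoint Aᶜ hA.compl))) :
    ∀ q : (Ω.cutFilm A hA).Vert, B ((Ω.cutFilm A hA).vertexClass q)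
  | ⟨Sum.inl _, none⟩ => y
  | ⟨Sum.inl _, some a⟩ =>
    LinearEquiv.cast (R := 𝕂) (M := B) (Ω.vertexClass_cutVert A hA a).symm (x a)
  | ⟨Sum.inr _, none⟩ => z
  | ⟨Sum.inr _, some a⟩ =>
    LinearEquiv.cast (R := 𝕂) (M := B) (Ω.vertexClass_cutVert Aᶜ hA.compl a).symm (x a)

open Classical in
theorem cutVectors_left (Ω : ConnectedFilm S) (A : Set Ω.Vert) (hA : IsDivision A)
    (x : ∀ q : Ω.Vert, B (Ω.vertexClass q))
    (y y' : B ((Ω.cut A hA).vertexClass (Ω.cutPoint A hA)))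
    (z : B ((Ω.cut Aᶜ hA.compl).vertexClass (Ω.cutPoint Aᶜ hA.compl))) :
    cutVectors 𝕂 Ω A hA x y' z = Function.update (cutVectors 𝕂 Ω A hA x y z)
      (FilmSurface.inl ⟨(), Ω.cutPoint A hA⟩) y' := by
  have key : ∀ q : (Ω.cutFilm A hA).Vert, q ≠ FilmSurface.inl ⟨(), Ω.cutPoint A hA⟩ →
      cutVectors 𝕂 Ω A hA x y' z q = cutVectors 𝕂 Ω A hA x y z q := by
    rintro ⟨_ | _, _ | a⟩ h
    all_goals first | rfl | exact (h rfl).elim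
  funext q
  by_cases hq : q = FilmSurface.inl ⟨(), Ω.cutPoint A hA⟩
  · subst hq
    exact (Function.update_self (f := cutVectors 𝕂 Ω A hA x y z)
      (FilmSurface.inl ⟨(), Ω.cutPoint A hA⟩ : (Ω.cutFilm A hA).Vert) y').symm
  · exact (key q hq).trans (Function.update_of_ne hq _ _).symm

open Classical in
theorem cutVectors_right (Ω : ConnectedFilm S) (A : Set Ω.Vert) (hA : IsDivision A)
    (x : ∀ q : Ω.Vert, B (Ω.vertexClass q))
    (y : B ((Ω.cut A hA).vertexClass (Ω.cutPoint A hA)))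
    (z z' : B ((Ω.cut Aᶜ hA.compl).vertexClass (Ω.cutPoint Aᶜ hA.compl))) :
    cutVectors 𝕂 Ω A hA x y z' = Function.update (cutVectors 𝕂 Ω A hA x y z)
      (FilmSurface.inr ⟨(), Ω.cutPoint Aᶜ hA.compl⟩) z' := by
  have key : ∀ q : (Ω.cutFilm A hA).Vert, q ≠ FilmSurface.inr ⟨(), Ω.cutPoint Aᶜ hA.compl⟩ →
      cutVectors 𝕂 Ω A hA x y z' q = cutVectors 𝕂 Ω A hA x y z q := by
    rintro ⟨_ | _, _ | a⟩ h
    all_goals first | rfl | exact (h rfl).elim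
  funext q
  by_cases hq : q = FilmSurface.inr ⟨(), Ω.cutPoint Aᶜ hA.compl⟩
  · subst hq
    exact (Function.update_self (f := cutVectors 𝕂 Ω A hA x y z)
      (FilmSurface.inr ⟨(), Ω.cutPoint Aᶜ hA.compl⟩ : (Ω.cutFilm A hA).Vert) z').symm
  · exact (key q hq).trans (Function.update_of_ne hq _ _).symm

variable {𝕂}

/-- The value of the form on the cut surface as a bilinear function of the vectors
`y ∈ B_σ = B_{q₊}`, `z ∈ B_{σ*} = B_{q₋}` at the new vertices, for fixed vectors at the old
vertices. -/
noncomputable def cutForm (Ω : ConnectedFilm S) (A : Set Ω.Vert) (hA : IsDivision A)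
    (Φ : FilmForm 𝕂 B (Ω.cutFilm A hA)) (x : ∀ q : Ω.Vert, B (Ω.vertexClass q)) :
    B ((Ω.cut A hA).vertexClass (Ω.cutPoint A hA)) →ₗ[𝕂]
      B ((Ω.cut A hA).vertexClass (Ω.cutPoint A hA)).star →ₗ[𝕂] 𝕂 :=
  LinearMap.mk₂ 𝕂
    (fun y z => Φ (cutVectors 𝕂 Ω A hA x y
      (LinearEquiv.cast (R := 𝕂) (M := B) (Ω.vertexClass_cutPoint A hA).symm z)))
    (fun y y' z => by
      classical
      have h := fun u => congrArg Φ (cutVectors_left 𝕂 Ω A hA x 0 u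
        (LinearEquiv.cast (R := 𝕂) (M := B) (Ω.vertexClass_cutPoint A hA).symm z))
      exact (h (y + y')).trans ((Φ.map_update_add _ (FilmSurface.inl ⟨(), Ω.cutPoint A hA⟩) y y').trans
        (congrArg₂ (· + ·) (h y).symm (h y').symm)))
    (fun c y z => by
      classical
      have h := fun u => congrArg Φ (cutVectors_left 𝕂 Ω A hA x 0 u
        (LinearEquiv.cast (R := 𝕂) (M := B) (Ω.vertexClass_cutPoint A hA).symm z))
      exact (h (c • y)).trans ((Φ.map_update_smul _ (FilmSurface.inl ⟨(), Ω.cutPoint A hA⟩) c y).trans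
        (congrArg (c • ·) (h y).symm)))
    (fun y z z' => by
      classical
      have h := fun u => congrArg Φ (cutVectors_right 𝕂 Ω A hA x y 0 u)
      rw [map_add]
      exact (h _).trans ((Φ.map_update_add _ (FilmSurface.inr ⟨(), Ω.cutPoint Aᶜ hA.compl⟩) _ _).trans
        (congrArg₂ (· + ·) (h _).symm (h _).symm)))
    (fun c y z => by
      classical
      have h := fun u => congrArg Φ (cutVectors_right 𝕂 Ω A hA x y 0 u)
      rw [map_smul]
      exact (h _).trans ((Φ.map_update_smul _ (FilmSurface.inr ⟨(), Ω.cutPoint Aᶜ hA.compl⟩) c _).trans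
        (congrArg (c • ·) (h _).symm)))

open Classical in
/-- The form `(x, y) = Φ_Ω (x_{q₁} ⊗ y_{q₂})` on `B_σ × B_{σ*}` that is given by a film surface `Ω`
with only two vertices `q₁`, `q₂`, where `σ = σ_{q₁}` and so `σ* = σ_{q₂}`. -/
noncomputable def pairing (Ω : ConnectedFilm S) (q₁ q₂ : Ω.Vert) (hne : q₁ ≠ q₂)
    (h : ∀ q, q = q₁ ∨ q = q₂) (Φ : FilmForm 𝕂 B Ω.toFilm)
    (x : B (Ω.vertexClass q₁)) (y : B (Ω.vertexClass q₁).star) : 𝕂 :=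
  Φ fun q =>
    if h' : q.2 = q₁ then
      LinearEquiv.cast (R := 𝕂) (M := B) (congrArg Ω.vertexClass h').symm x
    else
      LinearEquiv.cast (R := 𝕂) (M := B) ((Ω.vertexClass_eq_star hne h).symm.trans
        (congrArg Ω.vertexClass ((h q.2).resolve_left h')).symm) y

/-- The family of forms `Φ_Ω : V_Ω → 𝕂` on all film surfaces is a Film Topological Field Theory on
the vector spaces `B_σ` and the tensors `T_σ ∈ B_σ ⊗ B_{σ*}`, `σ ∈ Σ`. -/
structure IsFilmTFT (T : ∀ σ : GraphClass S, B σ ⊗[𝕂] B σ.star)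
    (Φ : ∀ Ω : FilmSurface S, FilmForm 𝕂 B Ω) : Prop where
  finiteDimensional : ∀ σ, FiniteDimensional 𝕂 (B σ)
  /-- `Φ_{Ω'}(φ_*(x)) = Φ_Ω(x)`, where `φ_*(x) = x'` is obtained from `x` by the bijection `φ` of the
  vertices -/
  topological_invariance : ∀ (Ω Ω' : FilmSurface S) (φ : Ω.Iso Ω')
    (x : ∀ q : Ω.Vert, B (Ω.vertexClass q)) (x' : ∀ q : Ω'.Vert, B (Ω'.vertexClass q)),
    (∀ q, x' (φ.vert q) =
      LinearEquiv.cast (R := 𝕂) (M := B) (FilmSurface.vertexClass_iso φ q).symm (x q)) →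
    Φ Ω' x' = Φ Ω x
  /-- The forms `(·,·)_σ` are nondegenerate; every `σ` is of the form `σ_{q₁}`, see
  `GraphClass.exists_suspension`. -/
  nondegenerate : ∀ (Ω : ConnectedFilm S) (q₁ q₂ : Ω.Vert) (hne : q₁ ≠ q₂)
    (h : ∀ q, q = q₁ ∨ q = q₂),
    (∀ x, (∀ y, pairing Ω q₁ q₂ hne h (Φ Ω.toFilm) x y = 0) → x = 0) ∧
    (∀ y, (∀ x, pairing Ω q₁ q₂ hne h (Φ Ω.toFilm) x y = 0) → y = 0)
  /-- `Φ_{Ω'}(x ⊗ T_σ) = Φ_Ω(x)`, where `Ω'` is the result of a cut of `Ω` and `σ = σ_{q₊}` -/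
  cut_invariance : ∀ (Ω : ConnectedFilm S) (A : Set Ω.Vert) (hA : IsDivision A)
    (x : ∀ q : Ω.Vert, B (Ω.vertexClass q)),
    TensorProduct.lift (cutForm Ω A hA (Φ (Ω.cutFilm A hA)) x)
      (T ((Ω.cut A hA).vertexClass (Ω.cutPoint A hA))) = Φ Ω.toFilm fun q => x q.2
  multiplicativity : ∀ (Ω' Ω'' : FilmSurface S)
    (x : ∀ q : (Ω'.disjUnion Ω'').Vert, B ((Ω'.disjUnion Ω'').vertexClass q)),
    Φ (Ω'.disjUnion Ω'') x =
      Φ Ω' (fun q => x (FilmSurface.inl q)) * Φ Ω'' (fun q => x (FilmSurface.inr q))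

end FieldTheory

/-! ### Equipments -/

section Equipment

variable {S : Type u} (G : S → Type w) (X : S → Type z) [∀ s, Group (G s)]
  [∀ s, MulAction (G s) (X s)]

/-- The group `⨁_{s ∈ S} G_s`: families of elements of the groups `G_s`, finitely many of which are
nontrivial. -/
def ColorGroup : Subgroup (∀ s, G s) where
  carrier := {g | {s | g s ≠ 1}.Finite}
  one_mem' := by simp
  mul_mem' {g h} hg hh := (Set.Finite.union hg hh).subset fun s hs => by
    by_contra h'
    simp only [Set.mem_union, Set.mem_ofPred_eq, not_or, not_not] at h'
    exact hs (by simp [h'.1, h'.2])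
  inv_mem' {g} hg := by simpa using hg

/-- Maps `ψ` that send an edge `l` of a coloured graph to a pair in `X_{s(l)} × X_{s(l)}`. -/
def GraphLabeling (σ : GraphClass S) : Type max u z := ∀ s : σ.colors, X s × X s

instance (σ : GraphClass S) : MulAction (ColorGroup G) (GraphLabeling X σ) where
  smul g ψ s := (g.1 s • (ψ s).1, g.1 s • (ψ s).2)
  one_smul ψ := funext fun s => Prod.ext (one_smul (G s) (ψ s).1) (one_smul (G s) (ψ s).2)
  mul_smul g h ψ := funext fun s =>
    Prod.ext (mul_smul (g.1 s) (h.1 s) (ψ s).1) (mul_smul (g.1 s) (h.1 s) (ψ s).2)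

/-- The set `E_σ` of equipments of a coloured graph, i.e. of orbits of labelings. -/
abbrev GraphEquipment (σ : GraphClass S) : Type max u z :=
  MulAction.orbitRel.Quotient (ColorGroup G) (GraphLabeling X σ)

variable {G X} in
/-- The map `E_σ → E_{σ*}` that inverts the orientation and swaps the components of
`X_s × X_s`. -/
def GraphEquipment.star {σ : GraphClass S} :
    GraphEquipment G X σ → GraphEquipment G X σ.star :=
  Quotient.map' (fun ψ s => (ψ ⟨s, GraphClass.mem_colors_star.1 s.2⟩).swap) (by
    rintro _ ψ ⟨g, rfl⟩
    exact ⟨g, rfl⟩)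

/-- The disk `d` is incident to the edge `e`. -/
def ConnectedFilm.Incident (Ω : ConnectedFilm S) (e : Ω.Edge) (d : Ω.Disk) : Prop :=
  ∃ f, Ω.edge f = e ∧ Ω.disk f = d

/-- Maps `ψ` that send an edge `e` of a film surface to an element of `X_{S(e)}`, the product of the
sets `X_s` over the colours `s` of the disks that are incident to `e`. -/
def FilmLabeling (Ω : ConnectedFilm S) : Type max u z :=
  ∀ (e : Ω.Edge) (d : {d // Ω.Incident e d}), X (Ω.color d)

instance (Ω : ConnectedFilm S) : MulAction (ColorGroup G) (FilmLabeling X Ω) where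
  smul g ψ e d := g.1 (Ω.color d) • ψ e d
  one_smul ψ := funext fun e => funext fun d => one_smul (G (Ω.color d)) (ψ e d)
  mul_smul g h ψ := funext fun e => funext fun d =>
    mul_smul (g.1 (Ω.color d)) (h.1 (Ω.color d)) (ψ e d)

/-- The set of equipments of a connected film surface. -/
abbrev FilmEquipment (Ω : ConnectedFilm S) : Type max u z :=
  MulAction.orbitRel.Quotient (ColorGroup G) (FilmLabeling X Ω)

variable {X} in
/-- The labeling `φ` of the graph of the vertex `q` is generated by the labeling `ψ` of the film
surface: if at `q` the disk of colour `s` has the side `f` that enters `q` and the side `g`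
that leaves `q`, so that the edge of colour `s` of the vertex graph goes from the edge of `f` to the
edge of `g`, then the label of this edge is the pair of the components of colour `s` of the labels of
the edges of `f` and `g`. -/
def Generates (Ω : ConnectedFilm S) (ψ : FilmLabeling X Ω) (q : Ω.Vert)
    (φ : GraphLabeling X (Ω.vertexClass q)) : Prop :=
  ∀ (f g : Ω.Side) (d : Ω.Disk) (hf : Ω.disk f = d) (hg : Ω.disk g = d),
    Ω.head f = q → Ω.tail g = q → ∀ h : Ω.color d ∈ (Ω.vertexClass q).colors,
      φ ⟨Ω.color d, h⟩ = (ψ (Ω.edge f) ⟨d, f, rfl, hf⟩, ψ (Ω.edge g) ⟨d, g, rfl, hg⟩)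

variable {G X} in
/-- The equipment `Ψ` of the film surface generates the equipment `ς` of the graph of the
vertex `q`. -/
def GeneratesEquipment (Ω : ConnectedFilm S) (Ψ : FilmEquipment G X Ω) (q : Ω.Vert)
    (ς : GraphEquipment G X (Ω.vertexClass q)) : Prop :=
  ∃ ψ φ, Generates Ω ψ q φ ∧ Ψ = Quotient.mk'' ψ ∧ ς = Quotient.mk'' φ

variable {G} in
/-- The order of the group of all `g ∈ ⨁_{s ∈ T} G_s` such that `g ψ = ψ`, where `ψ` is an element
of the given orbit. -/
noncomputable def autOrder (T : Set S) {α : Type*} [MulAction (ColorGroup G) α]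
    (o : MulAction.orbitRel.Quotient (ColorGroup G) α) : ℕ :=
  Nat.card {g : ColorGroup G // (∀ s ∉ T, g.1 s = 1) ∧ g • Quotient.out o = Quotient.out o}

variable {G X} in
/-- `|Aut (σ, ς)|`.  The parameter `c` fixes the group `⨁_{s ∈ c T} G_s` in which the stabilizers
for a graph or a film surface with the set of colours `T` are taken: `c T = T`, or `c T = S`. -/
noncomputable def GraphEquipment.aut (c : Set S → Set S) {σ : GraphClass S}
    (ς : GraphEquipment G X σ) : ℕ := autOrder (c σ.colors) ς

variable {G X} in
/-- `|Aut (Ω, Ψ)|`. -/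
noncomputable def FilmEquipment.aut (c : Set S → Set S) {Ω : ConnectedFilm S}
    (Ψ : FilmEquipment G X Ω) : ℕ := autOrder (c (Set.range Ω.color)) Ψ

variable (𝕂 : Type v) [Field 𝕂]

/-- The sum of `1 / |Aut Ψ|` over all equipments `Ψ` of the connected film surface `Ω` that generate
the equipment `ς q` of the graph of every vertex `q`. -/
noncomputable def equippedSum (c : Set S → Set S) (Ω : ConnectedFilm S)
    (ς : ∀ q, GraphEquipment G X (Ω.vertexClass q)) : 𝕂 :=
  ∑ᶠ Ψ : {Ψ : FilmEquipment G X Ω // ∀ q, GeneratesEquipment Ω Ψ q (ς q)},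
    1 / (FilmEquipment.aut c Ψ.1 : 𝕂)

/-- The vector space with the basis `E_σ`. -/
abbrev EquipmentSpace (σ : GraphClass S) : Type max u v z := GraphEquipment G X σ →₀ 𝕂

/-- The form `Φ_Ω` whose value on a tensor product of basis vectors `ς q` is the
product of the numbers `equippedSum` over the connected components of `Ω`. -/
noncomputable def equippedForm (c : Set S → Set S) (Ω : FilmSurface S) :
    FilmForm 𝕂 (EquipmentSpace G X 𝕂) Ω :=
  letI := Fintype.ofFinite Ω.Vert
  ∑ᶠ ς : ∀ q : Ω.Vert, GraphEquipment G X (Ω.vertexClass q),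
    (∏ i, equippedSum G X 𝕂 c (Ω.comp i) fun q => ς ⟨i, q⟩) •
      (MultilinearMap.mkPiAlgebra 𝕂 Ω.Vert 𝕂).compLinearMap fun q => Finsupp.lapply (ς q)

/-- The tensor `∑_{ς ∈ E_σ} |Aut ς| ς ⊗ ς*`. -/
noncomputable def equippedTensor (c : Set S → Set S) (σ : GraphClass S) :
    EquipmentSpace G X 𝕂 σ ⊗[𝕂] EquipmentSpace G X 𝕂 σ.star :=
  ∑ᶠ ς : GraphEquipment G X σ,
    (ς.aut c : 𝕂) • (Finsupp.single ς 1 ⊗ₜ[𝕂] Finsupp.single ς.star 1)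

end Equipment

/-!
A labeling of a connected film surface `Ω` amounts to an arbitrary family of labels of the sides of
its disks, because a disk passes an edge at most once; it generates honest labelings of the vertex
graphs, not just equipments.  By the orbit-stabilizer theorem, a sum over equipments weighted with
`1 / |Aut|` is a sum over labelings divided by the order of the group `H_Ω` in which stabilizers are
taken.  So `Φ_Ω` is the state sum `|H_Ω|⁻¹ ∑_ψ ∏_q x_q([ψ_q])` over all labelings `ψ` of `Ω`, where
`[ψ_q]` is the class of the labeling that `ψ` generates at `q` (`stateSum`, `equippedForm_apply`).

With this formula, topological invariance and multiplicativity are clear.  If `Ω` has two vertices,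
its labelings are the labelings `φ` of the graph of `q₁`, and they generate `φ` and `φ*`
(`FilmLabeling.gen_bijective`, `FilmLabeling.gen_eq_star`); this gives the pairing.

For a cut, `|Aut ς|` is the number of group elements that carry one labeling in the orbit `ς` to
another one (`FactorsThrough.card_transporter`).  So the contraction with the tensor is a sum over
pairs of labelings `ψ₊`, `ψ₋` of the two parts and over group elements `k` such that `ψ₊` and `k ψ₋`
generate opposite labelings at the new vertices.  Substituting `ψ₋` for `k ψ₋`, one gets `|H_σ|`
times the sum over the matching pairs (`sum_aut_mul_eq_sum_cutMatch`), and a matching pair is the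
same as a labeling of `Ω` (`FilmLabeling.restrict_bijective`).  The group orders fit, since the colours of `Ω`
are the union and those of the vertex graph are the intersection of the sets of colours of the two
parts.
-/

/-! ### Color groups, stabilizers and orbits -/

section ColorGroup

variable {S : Type u} {G : S → Type w} [∀ s, Group (G s)]

variable (G) in
/-- The subgroup `⨁_{s ∈ T} G_s` of `⨁_{s ∈ S} G_s`. -/
def supportSubgroup (T : Set S) : Subgroup (ColorGroup G) where
  carrier := {g | ∀ s ∉ T, g.1 s = 1}
  one_mem' _ _ := rfl
  mul_mem' {g h} hg hh s hs := by simp [hg s hs, hh s hs]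
  inv_mem' {g} hg s hs := by simp [hg s hs]

variable (G) in
/-- For finite `T`, the group `⨁_{s ∈ T} G_s` is the product of the groups `G_s`, `s ∈ T`. -/
noncomputable def supportSubgroupEquiv {T : Set S} (hT : T.Finite) :
    supportSubgroup G T ≃ ∀ s : T, G s := by
  classical
  exact {
    toFun := fun g s => g.1.1 s
    invFun := fun g => ⟨⟨fun s => if h : s ∈ T then g ⟨s, h⟩ else 1, by
      refine hT.subset fun s hs => ?_
      by_contra h
      exact hs (dif_neg h)⟩, fun s hs => dif_neg hs⟩
    left_inv := fun g => by
      refine Subtype.ext (Subtype.ext (funext fun s => ?_))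
      by_cases h : s ∈ T
      · simp [h]
      · simp [h, g.2 s h]
    right_inv := fun g => by
      funext s
      simp }

theorem finite_supportSubgroup [∀ s, Finite (G s)] {T : Set S} (hT : T.Finite) :
    Finite (supportSubgroup G T) :=
  have := hT.to_subtype
  Finite.of_equiv _ (supportSubgroupEquiv G hT).symm

theorem card_supportSubgroup {T : Set S} (hT : T.Finite) :
    Nat.card (supportSubgroup G T) = ∏ᶠ s ∈ T, Nat.card (G s) := by
  have := hT.fintype
  rw [Nat.card_congr (supportSubgroupEquiv G hT), Nat.card_pi,
    ← finprod_set_coe_eq_finprod_mem (f := fun s => Nat.card (G s)), finprod_eq_prod_of_fintype]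

theorem card_supportSubgroup_union_inter {P Q : Set S} (hP : P.Finite) (hQ : Q.Finite) :
    Nat.card (supportSubgroup G (P ∪ Q)) * Nat.card (supportSubgroup G (P ∩ Q)) =
      Nat.card (supportSubgroup G P) * Nat.card (supportSubgroup G Q) := by
  rw [card_supportSubgroup (hP.union hQ), card_supportSubgroup (hP.inter_of_left Q),
    card_supportSubgroup hP, card_supportSubgroup hQ, finprod_mem_union_inter hP hQ]

variable (G) in
/-- The action of `⨁_{s ∈ S} G_s` on `α` factors through the projection to `⨁_{s ∈ T} G_s`. -/
def FactorsThrough (T : Set S) (α : Type*) [MulAction (ColorGroup G) α] : Prop :=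
  ∀ (g : ColorGroup G) (a : α), (∀ s ∈ T, g.1 s = 1) → g • a = a

variable {T : Set S} {α : Type*} [MulAction (ColorGroup G) α]

theorem FactorsThrough.mono {T' : Set S} (h : FactorsThrough G T α) (hT : T ⊆ T') :
    FactorsThrough G T' α := fun g a hg => h g a fun s hs => hg s (hT hs)

/-- The orbits of `⨁_{s ∈ S} G_s` are orbits of `⨁_{s ∈ T} G_s`. -/
theorem FactorsThrough.exists_smul_eq (h : FactorsThrough G T α) {a b : α}
    (hab : (Quotient.mk'' a : MulAction.orbitRel.Quotient (ColorGroup G) α) = Quotient.mk'' b) :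
    ∃ k : supportSubgroup G T, k • a = b := by
  classical
  obtain ⟨g, rfl⟩ := MulAction.orbitRel_apply.1 (Quotient.eq''.1 hab.symm)
  let k : ColorGroup G := ⟨fun s => if s ∈ T then g.1 s else 1, by
    refine g.2.subset fun s hs => ?_
    intro h1
    exact hs (by simp [h1])⟩
  refine ⟨⟨k, fun s hs => if_neg hs⟩, ?_⟩
  -- `g` and its truncation `k` have the same components in `T`
  have h1 := h (g⁻¹ * k) a fun s hs => by simp [k, hs]
  rw [mul_smul, inv_smul_eq_iff] at h1
  exact h1

open Classical in
/-- The elements of a group that carry `a` to `b` form a coset of a stabilizer, if there are any. -/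
theorem FactorsThrough.card_transporter (h : FactorsThrough G T α) (a b : α) :
    Nat.card {k : supportSubgroup G T // k • a = b} =
      if (Quotient.mk'' a : MulAction.orbitRel.Quotient (ColorGroup G) α) = Quotient.mk'' b
      then autOrder T (Quotient.mk'' b : MulAction.orbitRel.Quotient (ColorGroup G) α) else 0 := by
  split_ifs with hab
  · have hb := Quotient.out_eq' (Quotient.mk'' b : MulAction.orbitRel.Quotient (ColorGroup G) α)
    obtain ⟨l, hl⟩ := h.exists_smul_eq hb
    obtain ⟨m, hm⟩ := h.exists_smul_eq (hb.trans hab.symm)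
    set o := Quotient.out (Quotient.mk'' b : MulAction.orbitRel.Quotient (ColorGroup G) α) with ho
    -- with `m o = a` and `l o = b`, the elements `k` with `k a = b` are the `l h m⁻¹`, `h o = o`
    have key : ∀ k : supportSubgroup G T, k • a = b ↔ (l⁻¹ * k * m) • o = o := by
      intro k
      rw [mul_smul, hm, mul_smul, inv_smul_eq_iff, hl]
    refine Nat.card_congr
      ((Equiv.subtypeEquiv ((Equiv.mulLeft l⁻¹).trans (Equiv.mulRight m)) key).trans
        (Equiv.subtypeSubtypeEquivSubtypeInter (· ∈ supportSubgroup G T) (fun g => g • o = o)))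
  · rw [Nat.card_eq_zero]
    refine Or.inl ⟨fun k => hab ?_⟩
    rw [← k.2]
    exact (Quotient.eq''.2 (MulAction.orbitRel_apply.2 ⟨k.1.1, rfl⟩)).symm

/-- The orbit-stabilizer theorem. -/
theorem FactorsThrough.card_orbit_mul_autOrder [Finite α] [Finite (supportSubgroup G T)]
    (h : FactorsThrough G T α) (o : MulAction.orbitRel.Quotient (ColorGroup G) α) :
    Nat.card {a : α // Quotient.mk'' a = o} * autOrder T o = Nat.card (supportSubgroup G T) := by
  classical
  have := Fintype.ofFinite α
  have := Fintype.ofFinite (supportSubgroup G T)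
  have h1 : ∀ b : α, Nat.card {k : supportSubgroup G T // k • Quotient.out o = b} =
      if Quotient.mk'' b = o then autOrder T o else 0 := by
    intro b
    rw [h.card_transporter, Quotient.out_eq']
    simp only [eq_comm (a := o)]
    split_ifs with h1
    · rw [h1]
    · rfl
  rw [Nat.card_congr (Equiv.sigmaFiberEquiv
    (fun k : supportSubgroup G T => k • Quotient.out o)).symm, Nat.card_sigma,
    Finset.sum_congr rfl fun b _ => h1 b, ← Finset.sum_filter, Finset.sum_const,
    smul_eq_mul, Nat.card_eq_fintype_card, Fintype.card_subtype]

theorem FactorsThrough.autOrder_ne_zero [Finite α] [Finite (supportSubgroup G T)]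
    (h : FactorsThrough G T α) (o : MulAction.orbitRel.Quotient (ColorGroup G) α) :
    autOrder T o ≠ 0 := by
  intro h'
  have := h.card_orbit_mul_autOrder o
  rw [h', mul_zero] at this
  exact Nat.card_pos.ne this

end ColorGroup

/-! ### Labelings of coloured graphs -/

section GraphLabeling

variable {S : Type u} {G : S → Type w} {X : S → Type z} [∀ s, Group (G s)]
  [∀ s, MulAction (G s) (X s)]

instance [∀ s, Finite (X s)] (σ : GraphClass S) : Finite (GraphLabeling X σ) :=
  have : Finite σ.colors := σ.finite
  inferInstanceAs (Finite (∀ s : σ.colors, X s × X s))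

theorem GraphLabeling.smul_apply {σ : GraphClass S} (g : ColorGroup G) (φ : GraphLabeling X σ)
    (s : σ.colors) : (g • φ) s = (g.1 s • (φ s).1, g.1 s • (φ s).2) := rfl

theorem GraphLabeling.factorsThrough (σ : GraphClass S) :
    FactorsThrough G σ.colors (GraphLabeling X σ) := by
  intro g φ h
  funext s
  rw [smul_apply, h s s.2, one_smul, one_smul]

/-- The labeling of the graph with inverted orientations. -/
def GraphLabeling.star {σ : GraphClass S} (φ : GraphLabeling X σ) : GraphLabeling X σ.star :=
  fun s => (φ ⟨s, GraphClass.mem_colors_star.1 s.2⟩).swap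

theorem GraphLabeling.star_injective {σ : GraphClass S} :
    Function.Injective (GraphLabeling.star : GraphLabeling X σ → GraphLabeling X σ.star) := by
  intro φ φ' h
  funext s
  exact Prod.swap_injective (congrFun h ⟨s, GraphClass.mem_colors_star.2 s.2⟩)

theorem GraphLabeling.star_surjective {σ : GraphClass S} :
    Function.Surjective (GraphLabeling.star : GraphLabeling X σ → GraphLabeling X σ.star) := by
  intro φ
  refine ⟨fun s => (φ ⟨s, GraphClass.mem_colors_star.2 s.2⟩).swap, ?_⟩
  funext s
  exact Prod.swap_swap _

theorem GraphEquipment.star_mk {σ : GraphClass S} (φ : GraphLabeling X σ) :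
    GraphEquipment.star (Quotient.mk'' φ : GraphEquipment G X σ) = Quotient.mk'' φ.star := rfl

theorem GraphEquipment.star_injective {σ : GraphClass S} :
    Function.Injective
      (GraphEquipment.star : GraphEquipment G X σ → GraphEquipment G X σ.star) := by
  rintro ⟨φ⟩ ⟨φ'⟩ h
  obtain ⟨g, hg⟩ := MulAction.orbitRel_apply.1 (Quotient.eq''.1 h)
  exact Quotient.eq''.2 (MulAction.orbitRel_apply.2 ⟨g, GraphLabeling.star_injective hg⟩)

theorem GraphEquipment.star_surjective {σ : GraphClass S} :
    Function.Surjective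
      (GraphEquipment.star : GraphEquipment G X σ → GraphEquipment G X σ.star) := by
  rintro ⟨φ⟩
  obtain ⟨φ, rfl⟩ := φ.star_surjective
  exact ⟨Quotient.mk'' φ, rfl⟩

/-- The transport of a labeling along an equality of classes. -/
def GraphLabeling.cast {σ σ' : GraphClass S} (h : σ = σ') (φ : GraphLabeling X σ) :
    GraphLabeling X σ' := fun s => φ ⟨s, h ▸ s.2⟩

theorem GraphLabeling.cast_smul {σ σ' : GraphClass S} (h : σ = σ') (g : ColorGroup G)
    (φ : GraphLabeling X σ) : GraphLabeling.cast h (g • φ) = g • GraphLabeling.cast h φ := rfl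

/-- Transport of a vector of `B_σ` along an equality of classes does not change its coordinates. -/
theorem cast_apply_mk {𝕂 : Type v} [Field 𝕂] {σ σ' : GraphClass S} (h : σ = σ')
    (x : EquipmentSpace G X 𝕂 σ) (φ : GraphLabeling X σ') :
    LinearEquiv.cast (R := 𝕂) (M := EquipmentSpace G X 𝕂) h x (Quotient.mk'' φ) =
      x (Quotient.mk'' (GraphLabeling.cast h.symm φ)) := by
  subst h
  rfl

end GraphLabeling

/-! ### Labelings of film surfaces -/

section FilmLabeling

variable {S : Type u} {G : S → Type w} {X : S → Type z} [∀ s, Group (G s)]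
  [∀ s, MulAction (G s) (X s)] {Ω : ConnectedFilm S}

instance [∀ s, Finite (X s)] : Finite (FilmLabeling X Ω) :=
  inferInstanceAs (Finite (∀ (e : Ω.Edge) (d : {d // Ω.Incident e d}), X (Ω.color d)))

theorem FilmLabeling.factorsThrough (Ω : ConnectedFilm S) :
    FactorsThrough G (Set.range Ω.color) (FilmLabeling X Ω) := by
  intro g ψ h
  funext e d
  change g.1 (Ω.color d) • ψ e d = ψ e d
  rw [h _ ⟨d.1, rfl⟩, one_smul]

/-- The component of colour `s` of the label of the edge of the side `f`, where `s` is the colour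
of the disk of `f`.  The equality of colours is an argument, so that sides of one disk give elements
of one and the same set `X s`. -/
def FilmLabeling.side (ψ : FilmLabeling X Ω) (f : Ω.Side) {s : S} (h : Ω.color (Ω.disk f) = s) :
    X s := h ▸ ψ (Ω.edge f) ⟨Ω.disk f, f, rfl, rfl⟩

theorem FilmLabeling.side_congr (ψ : FilmLabeling X Ω) {f g : Ω.Side} (hfg : f = g) {s : S}
    (h : Ω.color (Ω.disk f) = s) : ψ.side f h = ψ.side g (hfg ▸ h) := by
  subst hfg
  rfl

theorem FilmLabeling.side_smul (g : ColorGroup G) (ψ : FilmLabeling X Ω) (f : Ω.Side) {s : S}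
    (h : Ω.color (Ω.disk f) = s) : (g • ψ).side f h = g.1 s • ψ.side f h := by
  subst h
  rfl

theorem FilmLabeling.ext_side {ψ ψ' : FilmLabeling X Ω} (h : ∀ f, ψ.side f rfl = ψ'.side f rfl) :
    ψ = ψ' := by
  funext e d
  obtain ⟨_, f, rfl, rfl⟩ := d
  exact h f

/-- A labeling may be given by arbitrary labels of the sides, since a disk passes an edge at most
once. -/
theorem FilmLabeling.exists_side_eq (t : ∀ f : Ω.Side, X (Ω.color (Ω.disk f))) :
    ∃ ψ : FilmLabeling X Ω, ∀ f, ψ.side f rfl = t f := by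
  have key : ∀ f g (hd : Ω.disk g = Ω.disk f), Ω.edge g = Ω.edge f →
      (hd ▸ t g : X (Ω.color (Ω.disk f))) = t f := by
    intro f g hd he
    obtain rfl := Ω.edge_injective g f hd he
    rfl
  exact ⟨fun e d => d.2.choose_spec.2 ▸ t d.2.choose, fun f => key _ _ _ (Exists.choose_spec
    (⟨f, rfl, rfl⟩ : Ω.Incident (Ω.edge f) (Ω.disk f))).1⟩

theorem ConnectedFilm.isEnd_unique {q : Ω.Vert} {s : S} {b : Bool} {f g : Ω.Side}
    (hf : Ω.IsEnd q s b f) (hg : Ω.IsEnd q s b g) : f = g := by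
  have hd := Ω.color_injective (hf.1.trans hg.1.symm)
  have h := hf.2.trans hg.2.symm
  cases b
  · exact Ω.head_injective _ _ hd h
  · exact Ω.tail_injective _ _ hd h

theorem ConnectedFilm.mem_colors_iff {q : Ω.Vert} {s : S} (b : Bool) :
    s ∈ (Ω.vertexClass q).colors ↔ ∃ f, Ω.IsEnd q s b f := by
  have h : ∀ b, (Ω.vertexClass q).glue (s, b) (s, b) ↔ ∃ f, Ω.IsEnd q s b f := by
    intro b
    rw [Ω.vertexClass_glue]
    exact ⟨fun ⟨f, _, hf, _⟩ => ⟨f, hf⟩, fun ⟨f, hf⟩ => ⟨f, f, hf, hf, rfl⟩⟩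
  cases b
  · exact h false
  · rw [← h]
    exact ⟨fun h => (Ω.vertexClass q).flip h, fun h => (Ω.vertexClass q).flip h⟩

theorem ConnectedFilm.colors_subset (q : Ω.Vert) :
    (Ω.vertexClass q).colors ⊆ Set.range Ω.color := by
  intro s hs
  obtain ⟨f, hf, -⟩ := (Ω.mem_colors_iff true).1 hs
  exact ⟨_, hf⟩

/-- The side of the disk of colour `s` that leaves (`b = true`) or enters (`b = false`) `q`. -/
noncomputable def ConnectedFilm.sideAt (Ω : ConnectedFilm S) (q : Ω.Vert)
    (s : (Ω.vertexClass q).colors) (b : Bool) : Ω.Side :=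
  ((Ω.mem_colors_iff b).1 s.2).choose

theorem ConnectedFilm.isEnd_sideAt (q : Ω.Vert) (s : (Ω.vertexClass q).colors) (b : Bool) :
    Ω.IsEnd q s b (Ω.sideAt q s b) := ((Ω.mem_colors_iff b).1 s.2).choose_spec

/-- The labeling of the graph of the vertex `q` that is generated by `ψ`. -/
noncomputable def FilmLabeling.gen (ψ : FilmLabeling X Ω) (q : Ω.Vert) :
    GraphLabeling X (Ω.vertexClass q) := fun s =>
  (ψ.side _ (Ω.isEnd_sideAt q s false).1, ψ.side _ (Ω.isEnd_sideAt q s true).1)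

theorem FilmLabeling.gen_apply (ψ : FilmLabeling X Ω) {q : Ω.Vert} {f g : Ω.Side}
    (s : (Ω.vertexClass q).colors) (hf : Ω.IsEnd q s false f) (hg : Ω.IsEnd q s true g) :
    ψ.gen q s = (ψ.side f hf.1, ψ.side g hg.1) :=
  Prod.ext (ψ.side_congr (Ω.isEnd_unique (Ω.isEnd_sideAt q s false) hf) _)
    (ψ.side_congr (Ω.isEnd_unique (Ω.isEnd_sideAt q s true) hg) _)

theorem FilmLabeling.gen_smul (g : ColorGroup G) (ψ : FilmLabeling X Ω) (q : Ω.Vert) :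
    (g • ψ).gen q = g • ψ.gen q := by
  funext s
  simp only [gen, GraphLabeling.smul_apply, side_smul]

theorem generates_iff (ψ : FilmLabeling X Ω) (q : Ω.Vert) (φ : GraphLabeling X (Ω.vertexClass q)) :
    Generates Ω ψ q φ ↔ φ = ψ.gen q := by
  constructor
  · intro h
    funext ⟨s, hs⟩
    obtain ⟨f, hf⟩ := (Ω.mem_colors_iff false).1 hs
    obtain ⟨g, hg⟩ := (Ω.mem_colors_iff true).1 hs
    have hd := Ω.color_injective (hg.1.trans hf.1.symm)
    obtain ⟨rfl, hf'⟩ := hf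
    rw [h f g _ rfl hd hf' hg.2, ψ.gen_apply _ ⟨rfl, hf'⟩ hg]
    refine Prod.ext rfl ?_
    have key : ∀ d (hd : Ω.disk g = d) (h : Ω.color (Ω.disk g) = Ω.color d),
        ψ (Ω.edge g) ⟨d, g, rfl, hd⟩ = ψ.side g h := by
      rintro _ rfl h
      rfl
    exact key _ hd _
  · rintro rfl f g d hf rfl hf' hg' h
    have h1 : Ω.IsEnd q (Ω.color (Ω.disk g)) false f := ⟨congrArg _ hf, hf'⟩
    rw [ψ.gen_apply ⟨_, h⟩ h1 ⟨rfl, hg'⟩]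
    refine Prod.ext ?_ rfl
    have key : ∀ d (hd : Ω.disk f = d) (h : Ω.color (Ω.disk f) = Ω.color d),
        ψ (Ω.edge f) ⟨d, f, rfl, hd⟩ = ψ.side f h := by
      rintro _ rfl h
      rfl
    exact (key _ hf _).symm

theorem generatesEquipment_mk_iff (ψ : FilmLabeling X Ω) (q : Ω.Vert)
    (ς : GraphEquipment G X (Ω.vertexClass q)) :
    GeneratesEquipment Ω (Quotient.mk'' ψ) q ς ↔ Quotient.mk'' (ψ.gen q) = ς := by
  constructor
  · rintro ⟨ψ', φ, h, h1, rfl⟩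
    obtain rfl := (generates_iff ψ' q φ).1 h
    obtain ⟨g, rfl⟩ := MulAction.orbitRel_apply.1 (Quotient.eq''.1 h1)
    exact Quotient.eq''.2 (MulAction.orbitRel_apply.2 ⟨g, (ψ'.gen_smul g q).symm⟩)
  · rintro rfl
    exact ⟨ψ, _, (generates_iff ψ q _).2 rfl, rfl, rfl⟩

end FilmLabeling

/-! ### The forms as state sums -/

section StateSum

variable {S : Type u} {G : S → Type w} {X : S → Type z} [∀ s, Group (G s)]
  [∀ s, MulAction (G s) (X s)]

/-- The two conventions for the groups in which stabilizers are taken: `⨁_{s ∈ T} G_s` for a graph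
or a surface with the set of colours `T`, or the whole group if it is finite. -/
def StabilizerConvention (G : S → Type w) [∀ s, Group (G s)] (c : Set S → Set S) : Prop :=
  c = id ∨ (c = fun _ => Set.univ) ∧ Finite (ColorGroup G)

namespace StabilizerConvention

variable {c : Set S → Set S} (hc : StabilizerConvention G c)
include hc

theorem subset (T : Set S) : T ⊆ c T := by
  obtain rfl | ⟨rfl, -⟩ := hc
  · exact subset_rfl
  · exact Set.subset_univ T

theorem finite [∀ s, Finite (G s)] {T : Set S} (hT : T.Finite) :
    Finite (supportSubgroup G (c T)) := by
  obtain rfl | ⟨rfl, h⟩ := hc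
  · exact finite_supportSubgroup hT
  · infer_instance

theorem card_union_inter {P Q : Set S} (hP : P.Finite) (hQ : Q.Finite) :
    Nat.card (supportSubgroup G (c (P ∪ Q))) * Nat.card (supportSubgroup G (c (P ∩ Q))) =
      Nat.card (supportSubgroup G (c P)) * Nat.card (supportSubgroup G (c Q)) := by
  obtain rfl | ⟨rfl, h⟩ := hc
  · exact card_supportSubgroup_union_inter hP hQ
  · rfl

end StabilizerConvention

variable {𝕂 : Type v} [Field 𝕂]

/-- The order of the group in which the stabilizers for colours `T` are taken. -/
noncomputable def groupOrder (G : S → Type w) [∀ s, Group (G s)] (𝕂 : Type v) [Field 𝕂]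
    (c : Set S → Set S) (T : Set S) : 𝕂 := Nat.card (supportSubgroup G (c T))

/-- The sum, over all labelings `ψ` of the surface, of the products of the coordinates of the
vectors `x q` at the equipments of the vertex graphs that `ψ` generates, divided by the order of the
group in which the stabilizers are taken. -/
noncomputable def stateSum (c : Set S → Set S) (Ω : ConnectedFilm S)
    (x : ∀ q, EquipmentSpace G X 𝕂 (Ω.vertexClass q)) : 𝕂 :=
  (groupOrder G 𝕂 c (Set.range Ω.color))⁻¹ *
    ∑ᶠ ψ : FilmLabeling X Ω, ∏ᶠ q, x q (Quotient.mk'' (ψ.gen q))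

theorem stateSum_eq_sum (c : Set S → Set S) (Ω : ConnectedFilm S) [Fintype Ω.Vert]
    [Fintype (FilmLabeling X Ω)] (x : ∀ q, EquipmentSpace G X 𝕂 (Ω.vertexClass q)) :
    stateSum c Ω x = (groupOrder G 𝕂 c (Set.range Ω.color))⁻¹ *
      ∑ ψ : FilmLabeling X Ω, ∏ q, x q (Quotient.mk'' (ψ.gen q)) := by
  simp only [stateSum, finsum_eq_sum_of_fintype, finprod_eq_prod_of_fintype]

variable [∀ s, Finite (G s)] [∀ s, Finite (X s)] [CharZero 𝕂] {c : Set S → Set S}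
  (hc : StabilizerConvention G c)

include hc in
theorem StabilizerConvention.groupOrder_ne_zero {T : Set S} (hT : T.Finite) :
    groupOrder G 𝕂 c T ≠ 0 := by
  have := hc.finite hT
  exact Nat.cast_ne_zero.2 Nat.card_pos.ne'

open Classical in
include hc in
/-- The sum over equipments, weighted with the inverse orders of their stabilizers, is the number of
labelings, divided by the order of the group. -/
theorem equippedSum_eq_sum (Ω : ConnectedFilm S) [Fintype (FilmLabeling X Ω)]
    (ς : ∀ q, GraphEquipment G X (Ω.vertexClass q)) :
    equippedSum G X 𝕂 c Ω ς = (groupOrder G 𝕂 c (Set.range Ω.color))⁻¹ *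
      ∑ ψ : FilmLabeling X Ω, if ∀ q, Quotient.mk'' (ψ.gen q) = ς q then 1 else 0 := by
  have hT := Set.finite_range Ω.color
  have := hc.finite hT
  have hF : FactorsThrough G (c (Set.range Ω.color)) (FilmLabeling X Ω) :=
    (FilmLabeling.factorsThrough Ω).mono (hc.subset _)
  have : Fintype (FilmEquipment G X Ω) := Fintype.ofFinite _
  have h1 : ∀ Ψ : FilmEquipment G X Ω, 1 / (FilmEquipment.aut c Ψ : 𝕂) =
      (groupOrder G 𝕂 c (Set.range Ω.color))⁻¹ *
        ∑ ψ : FilmLabeling X Ω, if Quotient.mk'' ψ = Ψ then 1 else 0 := by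
    intro Ψ
    have h2 := hF.card_orbit_mul_autOrder Ψ
    have h3 : (FilmEquipment.aut c Ψ : 𝕂) ≠ 0 := Nat.cast_ne_zero.2 (hF.autOrder_ne_zero Ψ)
    rw [Finset.sum_boole, ← Fintype.card_subtype, ← Nat.card_eq_fintype_card,
      eq_inv_mul_iff_mul_eq₀ (hc.groupOrder_ne_zero hT), groupOrder, ← h2, Nat.cast_mul]
    change _ * (FilmEquipment.aut c Ψ : 𝕂) * _ = _
    field_simp
  rw [equippedSum, finsum_eq_sum_of_fintype]
  simp only [h1]
  rw [← Finset.mul_sum, Finset.sum_comm]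
  congr 1
  refine Finset.sum_congr rfl fun ψ _ => ?_
  have h4 : (∀ q, GeneratesEquipment Ω (Quotient.mk'' ψ : FilmEquipment G X Ω) q (ς q)) ↔
      ∀ q, Quotient.mk'' (ψ.gen q) = ς q :=
    forall_congr' fun q => generatesEquipment_mk_iff ψ q (ς q)
  split_ifs with h
  · rw [Finset.sum_eq_single (⟨Quotient.mk'' ψ, h4.2 h⟩ : {Ψ : FilmEquipment G X Ω //
      ∀ q, GeneratesEquipment Ω Ψ q (ς q)})]
    · simp
    · intro Ψ _ hΨ
      exact if_neg fun h' => hΨ (Subtype.ext h'.symm)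
    · simp
  · refine Finset.sum_eq_zero fun Ψ _ => if_neg fun h' => h (h4.1 ?_)
    rw [h']
    exact Ψ.2

include hc in
/-- The form of a film surface is the product of the state sums of its connected components. -/
theorem equippedForm_apply (Ω : FilmSurface S)
    (x : ∀ q : Ω.Vert, EquipmentSpace G X 𝕂 (Ω.vertexClass q)) :
    equippedForm G X 𝕂 c Ω x = ∏ i, stateSum c (Ω.comp i) fun q => x ⟨i, q⟩ := by
  classical
  have hV : ∀ i, Fintype (Ω.comp i).Vert := fun i => Fintype.ofFinite _
  have hL : ∀ i, Fintype (FilmLabeling X (Ω.comp i)) := fun i => Fintype.ofFinite _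
  have hE : ∀ q : Ω.Vert, Fintype (GraphEquipment G X (Ω.vertexClass q)) :=
    fun q => Fintype.ofFinite _
  rw [equippedForm, finsum_eq_sum_of_fintype, sum_apply]
  have h1 : ∀ ς : ∀ q : Ω.Vert, GraphEquipment G X (Ω.vertexClass q),
      ∏ i, equippedSum G X 𝕂 c (Ω.comp i) (fun q => ς ⟨i, q⟩) =
        (∏ i, (groupOrder G 𝕂 c (Set.range (Ω.comp i).color))⁻¹) *
          ∑ ψ : ∀ i, FilmLabeling X (Ω.comp i),
            if (fun q : Ω.Vert => Quotient.mk'' ((ψ q.1).gen q.2)) = ς then 1 else 0 := by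
    intro ς
    simp only [equippedSum_eq_sum hc]
    rw [Finset.prod_mul_distrib, Finset.prod_univ_sum, Fintype.piFinset_univ]
    congr 1
    refine Finset.sum_congr rfl fun ψ _ => ?_
    split_ifs with h
    · exact Finset.prod_eq_one fun i _ => if_pos fun q => congrFun h ⟨i, q⟩
    · obtain ⟨⟨i, q⟩, hq⟩ := Function.ne_iff.1 h
      exact Finset.prod_eq_zero (Finset.mem_univ i) (if_neg fun h' => hq (h' q))
  have h2 : ∀ (_ : Fintype Ω.Vert) (ς : ∀ q : Ω.Vert, GraphEquipment G X (Ω.vertexClass q)),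
      ((MultilinearMap.mkPiAlgebra 𝕂 Ω.Vert 𝕂).compLinearMap
        fun q => Finsupp.lapply (ς q)) x = ∏ q : Ω.Vert, x q (ς q) := fun _ _ => rfl
  simp only [smul_apply, h1, smul_eq_mul]
  simp only [mul_assoc, stateSum_eq_sum]
  rw [← Finset.mul_sum, Finset.prod_mul_distrib, Finset.prod_univ_sum, Fintype.piFinset_univ]
  congr 1
  simp only [Finset.sum_mul]
  rw [Finset.sum_comm]
  refine Finset.sum_congr rfl fun ψ _ => ?_
  simp only [ite_mul, one_mul, zero_mul, Finset.sum_ite_eq, Finset.mem_univ, if_true]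
  refine (h2 _ _).trans ?_
  convert Fintype.prod_sigma fun q : Ω.Vert => x q (Quotient.mk'' ((ψ q.1).gen q.2))

include hc in
theorem equippedForm_toFilm (Ω : ConnectedFilm S)
    (x : ∀ q : Ω.toFilm.Vert, EquipmentSpace G X 𝕂 (Ω.vertexClass q.2)) :
    equippedForm G X 𝕂 c Ω.toFilm x = stateSum c Ω fun q => x ⟨(), q⟩ := by
  rw [equippedForm_apply hc]
  exact Fintype.prod_unique _

include hc in
theorem equippedForm_disjUnion (Ω' Ω'' : FilmSurface S)
    (x : ∀ q : (Ω'.disjUnion Ω'').Vert, EquipmentSpace G X 𝕂 ((Ω'.disjUnion Ω'').vertexClass q)) :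
    equippedForm G X 𝕂 c (Ω'.disjUnion Ω'') x =
      equippedForm G X 𝕂 c Ω' (fun q => x (FilmSurface.inl q)) *
        equippedForm G X 𝕂 c Ω'' (fun q => x (FilmSurface.inr q)) := by
  refine (equippedForm_apply hc _ x).trans ((Fintype.prod_sum_type _).trans ?_)
  exact congrArg₂ (· * ·) (equippedForm_apply hc Ω' fun q => x (FilmSurface.inl q)).symm
    (equippedForm_apply hc Ω'' fun q => x (FilmSurface.inr q)).symm

include hc in
theorem equippedForm_single (Ω : ConnectedFilm S)
    (ς : ∀ q, GraphEquipment G X (Ω.vertexClass q)) :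
    equippedForm G X 𝕂 c Ω.toFilm (fun q => Finsupp.single (ς q.2) 1) =
      equippedSum G X 𝕂 c Ω ς := by
  classical
  have := Fintype.ofFinite Ω.Vert
  have := Fintype.ofFinite (FilmLabeling X Ω)
  rw [equippedForm_toFilm hc, stateSum_eq_sum, equippedSum_eq_sum hc]
  congr 1
  refine Finset.sum_congr rfl fun ψ _ => ?_
  simp only [Finsupp.single_apply, Finset.prod_boole, Finset.mem_univ, forall_true_left,
    eq_comm]

end StateSum

/-! ### Topological invariance -/

section Invariance

variable {S : Type u} {G : S → Type w} {X : S → Type z} [∀ s, Group (G s)]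
  [∀ s, MulAction (G s) (X s)] {Ω Ω' : ConnectedFilm S}

theorem ConnectedFilm.Iso.color_side (φ : Ω.Iso Ω') (f : Ω.Side) :
    Ω'.color (Ω'.disk (φ.side f)) = Ω.color (Ω.disk f) :=
  (congrArg _ (φ.disk_side f)).trans (φ.color_disk _)

/-- The labeling of `Ω` that corresponds to a labeling of an isomorphic surface. -/
noncomputable def FilmLabeling.pull (φ : Ω.Iso Ω') (ψ : FilmLabeling X Ω') : FilmLabeling X Ω :=
  (FilmLabeling.exists_side_eq fun f => ψ.side (φ.side f) (φ.color_side f)).choose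

theorem FilmLabeling.side_pull (φ : Ω.Iso Ω') (ψ : FilmLabeling X Ω') (f : Ω.Side) {s : S}
    (h : Ω.color (Ω.disk f) = s) :
    (ψ.pull φ).side f h = ψ.side (φ.side f) ((φ.color_side f).trans h) := by
  subst h
  exact (FilmLabeling.exists_side_eq fun f => ψ.side (φ.side f) (φ.color_side f)).choose_spec f

theorem FilmLabeling.pull_bijective (φ : Ω.Iso Ω') :
    Function.Bijective (FilmLabeling.pull φ : FilmLabeling X Ω' → FilmLabeling X Ω) := by
  constructor
  · intro ψ ψ' h
    refine FilmLabeling.ext_side fun f' => ?_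
    obtain ⟨f, rfl⟩ := φ.side.surjective f'
    have := congrArg (fun ψ : FilmLabeling X Ω => ψ.side f (φ.color_side f).symm) h
    simpa only [side_pull] using this
  · intro ψ
    have hcol : ∀ f', Ω.color (Ω.disk (φ.side.symm f')) = Ω'.color (Ω'.disk f') := fun f' => by
      rw [← φ.color_side, φ.side.apply_symm_apply]
    obtain ⟨ψ', hψ'⟩ := FilmLabeling.exists_side_eq fun f' => ψ.side (φ.side.symm f') (hcol f')
    have hs : ∀ f' {s} (h : Ω'.color (Ω'.disk f') = s),
        ψ'.side f' h = ψ.side (φ.side.symm f') ((hcol f').trans h) := by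
      rintro f' _ rfl
      exact hψ' f'
    refine ⟨ψ', FilmLabeling.ext_side fun f => ?_⟩
    rw [side_pull, hs]
    exact ψ.side_congr (φ.side.symm_apply_apply f) _

theorem FilmLabeling.gen_pull (φ : Ω.Iso Ω') (ψ : FilmLabeling X Ω') (q : Ω.Vert) :
    (ψ.pull φ).gen q =
      GraphLabeling.cast (ConnectedFilm.vertexClass_iso φ q) (ψ.gen (φ.vert q)) := by
  have hend : ∀ {s b f}, Ω.IsEnd q s b f → Ω'.IsEnd (φ.vert q) s b (φ.side f) := by
    rintro s b f ⟨h1, h2⟩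
    refine ⟨(φ.color_side f).trans h1, ?_⟩
    cases b
    · exact (φ.head_side f).trans (congrArg _ h2)
    · exact (φ.tail_side f).trans (congrArg _ h2)
  funext s
  have h1 := Ω.isEnd_sideAt q s false
  have h2 := Ω.isEnd_sideAt q s true
  rw [gen_apply _ s h1 h2, GraphLabeling.cast, gen_apply _ _ (hend h1) (hend h2), side_pull,
    side_pull]

theorem stateSum_iso {𝕂 : Type v} [Field 𝕂] [∀ s, Finite (X s)] (c : Set S → Set S)
    (φ : Ω.Iso Ω') (x : ∀ q, EquipmentSpace G X 𝕂 (Ω.vertexClass q))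
    (x' : ∀ q, EquipmentSpace G X 𝕂 (Ω'.vertexClass q))
    (h : ∀ q, x' (φ.vert q) = LinearEquiv.cast (R := 𝕂) (M := EquipmentSpace G X 𝕂)
      (ConnectedFilm.vertexClass_iso φ q).symm (x q)) :
    stateSum c Ω' x' = stateSum c Ω x := by
  have := Fintype.ofFinite Ω.Vert
  have := Fintype.ofFinite Ω'.Vert
  have := Fintype.ofFinite (FilmLabeling X Ω)
  have := Fintype.ofFinite (FilmLabeling X Ω')
  have hr : Set.range Ω'.color = Set.range Ω.color := by
    rw [← φ.disk.surjective.range_comp]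
    exact congrArg Set.range (funext φ.color_disk)
  rw [stateSum_eq_sum, stateSum_eq_sum, hr]
  congr 1
  refine Fintype.sum_bijective _ (FilmLabeling.pull_bijective φ) _ _ fun ψ => ?_
  rw [← φ.vert.prod_comp]
  refine Finset.prod_congr rfl fun q _ => ?_
  rw [h, cast_apply_mk, FilmLabeling.gen_pull]

end Invariance

/-! ### The pairing -/

section Pairing

variable {S : Type u} {G : S → Type w} {X : S → Type z} [∀ s, Group (G s)]
  [∀ s, MulAction (G s) (X s)] {Ω : ConnectedFilm S} {q₁ q₂ : Ω.Vert}

theorem ConnectedFilm.isEnd_not (h : ∀ q, q = q₁ ∨ q = q₂) {s : S} {b : Bool}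
    {f : Ω.Side} (hf : Ω.IsEnd q₁ s b f) : Ω.IsEnd q₂ s (!b) f := by
  refine ⟨hf.1, ?_⟩
  have h1 := hf.2
  have h2 := Ω.tail_ne_head f
  cases b
  · exact (h _).resolve_left fun h3 => h2 (h3.trans h1.symm)
  · exact (h _).resolve_left fun h3 => h2 (h1.trans h3.symm)

theorem ConnectedFilm.range_color (h : ∀ q, q = q₁ ∨ q = q₂) :
    Set.range Ω.color = (Ω.vertexClass q₁).colors := by
  refine Set.Subset.antisymm ?_ (Ω.colors_subset q₁)
  rintro _ ⟨d, rfl⟩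
  obtain ⟨f, rfl⟩ := Ω.disk_surjective d
  rcases h (Ω.tail f) with h1 | h1
  · exact (Ω.mem_colors_iff true).2 ⟨f, rfl, h1⟩
  · exact (Ω.mem_colors_iff false).2 ⟨f, rfl, (h _).resolve_right fun h2 =>
      Ω.tail_ne_head f (h1.trans h2.symm)⟩

/-- A disk that passes just two vertices enters the one along the side on which it leaves the
other. -/
theorem FilmLabeling.gen_eq_star (hne : q₁ ≠ q₂) (h : ∀ q, q = q₁ ∨ q = q₂)
    (ψ : FilmLabeling X Ω) :
    GraphLabeling.cast (Ω.vertexClass_eq_star hne h) (ψ.gen q₂) = (ψ.gen q₁).star := by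
  funext s
  have h1 := Ω.isEnd_sideAt q₁ ⟨s, GraphClass.mem_colors_star.1 s.2⟩ false
  have h2 := Ω.isEnd_sideAt q₁ ⟨s, GraphClass.mem_colors_star.1 s.2⟩ true
  rw [GraphLabeling.cast, GraphLabeling.star, gen_apply _ _ h1 h2,
    gen_apply _ _ (Ω.isEnd_not h h2) (Ω.isEnd_not h h1)]
  rfl

/-- On a surface with two vertices, every side touches `q₁`, so that a labeling of the surface is
the same as a labeling of the graph of `q₁`. -/
theorem FilmLabeling.gen_bijective (h : ∀ q, q = q₁ ∨ q = q₂) :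
    Function.Bijective fun ψ : FilmLabeling X Ω => ψ.gen q₁ := by
  classical
  have hcol : ∀ f, Ω.color (Ω.disk f) ∈ (Ω.vertexClass q₁).colors := fun f => by
    rw [← Ω.range_color h]
    exact ⟨_, rfl⟩
  have hend : ∀ f, Ω.tail f ≠ q₁ → Ω.head f = q₁ := fun f h1 => (h _).resolve_right fun h2 =>
    Ω.tail_ne_head f (((h _).resolve_left h1).trans h2.symm)
  constructor
  · intro ψ ψ' hψ
    refine FilmLabeling.ext_side fun f => ?_
    have h1 := Ω.isEnd_sideAt q₁ ⟨_, hcol f⟩ false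
    have h2 := Ω.isEnd_sideAt q₁ ⟨_, hcol f⟩ true
    have h3 := congrFun hψ ⟨_, hcol f⟩
    simp only [gen_apply _ _ h1 h2, Prod.mk.injEq] at h3
    by_cases hf : Ω.tail f = q₁
    · have h4 : Ω.IsEnd q₁ _ true f := ⟨rfl, hf⟩
      have h5 := Ω.isEnd_unique h4 h2
      exact (ψ.side_congr h5 rfl).trans (h3.2.trans (ψ'.side_congr h5 rfl).symm)
    · have h4 : Ω.IsEnd q₁ _ false f := ⟨rfl, hend f hf⟩
      have h5 := Ω.isEnd_unique h4 h1
      exact (ψ.side_congr h5 rfl).trans (h3.1.trans (ψ'.side_congr h5 rfl).symm)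
  · intro φ
    obtain ⟨ψ, hψ⟩ := FilmLabeling.exists_side_eq fun f : Ω.Side =>
      if Ω.tail f = q₁ then (φ ⟨_, hcol f⟩).2 else (φ ⟨_, hcol f⟩).1
    have hs : ∀ f {s} (h : Ω.color (Ω.disk f) = s), ψ.side f h =
        if Ω.tail f = q₁ then (φ ⟨s, h ▸ hcol f⟩).2 else (φ ⟨s, h ▸ hcol f⟩).1 := by
      rintro f _ rfl
      exact hψ f
    refine ⟨ψ, funext fun s => ?_⟩
    have h1 := Ω.isEnd_sideAt q₁ s false
    have h2 := Ω.isEnd_sideAt q₁ s true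
    have h3 : Ω.tail (Ω.sideAt q₁ s false) ≠ q₁ := fun h3 =>
      Ω.tail_ne_head _ (h3.trans h1.2.symm)
    have h4 : Ω.tail (Ω.sideAt q₁ s true) = q₁ := h2.2
    simp only [gen_apply _ _ h1 h2, hs, if_neg h3, if_pos h4]

variable {𝕂 : Type v} [Field 𝕂] [CharZero 𝕂] [∀ s, Finite (G s)] [∀ s, Finite (X s)]
  {c : Set S → Set S} (hc : StabilizerConvention G c)

include hc in
theorem pairing_eq_sum (hne : q₁ ≠ q₂) (h : ∀ q, q = q₁ ∨ q = q₂)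
    [Fintype (GraphLabeling X (Ω.vertexClass q₁))]
    (x : EquipmentSpace G X 𝕂 (Ω.vertexClass q₁))
    (y : EquipmentSpace G X 𝕂 (Ω.vertexClass q₁).star) :
    pairing Ω q₁ q₂ hne h (equippedForm G X 𝕂 c Ω.toFilm) x y =
      (groupOrder G 𝕂 c (Ω.vertexClass q₁).colors)⁻¹ *
        ∑ φ : GraphLabeling X (Ω.vertexClass q₁),
          x (Quotient.mk'' φ) * y (Quotient.mk'' φ.star) := by
  classical
  have := Fintype.ofFinite Ω.Vert
  have := Fintype.ofFinite (FilmLabeling X Ω)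
  rw [pairing, equippedForm_toFilm hc, stateSum_eq_sum, Ω.range_color h]
  congr 1
  refine Fintype.sum_bijective _ (FilmLabeling.gen_bijective h) _ _ fun ψ => ?_
  rw [Fintype.prod_eq_mul q₁ q₂ hne fun q hq => ((h q).elim hq.1 hq.2).elim, dif_pos rfl,
    dif_neg hne.symm, cast_apply_mk, cast_apply_mk]
  congr 2
  exact congrArg _ (ψ.gen_eq_star hne h)

include hc in
/-- The size of an orbit of labelings, divided by the order of the group. -/
theorem inv_groupOrder_mul_sum_orbit (σ : GraphClass S) [Fintype (GraphLabeling X σ)]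
    [DecidableEq (GraphEquipment G X σ)] (ς : GraphEquipment G X σ) :
    (groupOrder G 𝕂 c σ.colors)⁻¹ *
      ∑ φ : GraphLabeling X σ, (if Quotient.mk'' φ = ς then 1 else 0) = 1 / (ς.aut c : 𝕂) := by
  have hF : FactorsThrough G (c σ.colors) (GraphLabeling X σ) :=
    (GraphLabeling.factorsThrough σ).mono (hc.subset _)
  have := hc.finite (T := σ.colors) σ.finite
  have h1 := hF.card_orbit_mul_autOrder ς
  have h2 : (ς.aut c : 𝕂) ≠ 0 := Nat.cast_ne_zero.2 (hF.autOrder_ne_zero ς)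
  rw [inv_mul_eq_iff_eq_mul₀ (hc.groupOrder_ne_zero σ.finite), Finset.sum_boole,
    ← Fintype.card_subtype, ← Nat.card_eq_fintype_card, groupOrder, ← h1, Nat.cast_mul]
  change _ = _ * (ς.aut c : 𝕂) * _
  field_simp

include hc in
theorem pairing_single_right (hne : q₁ ≠ q₂) (h : ∀ q, q = q₁ ∨ q = q₂)
    (x : EquipmentSpace G X 𝕂 (Ω.vertexClass q₁)) (ς : GraphEquipment G X (Ω.vertexClass q₁)) :
    pairing Ω q₁ q₂ hne h (equippedForm G X 𝕂 c Ω.toFilm) x (Finsupp.single ς.star 1) =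
      x ς * (1 / (ς.aut c : 𝕂)) := by
  classical
  have := Fintype.ofFinite (GraphLabeling X (Ω.vertexClass q₁))
  rw [pairing_eq_sum hc, ← inv_groupOrder_mul_sum_orbit hc, mul_left_comm]
  congr 1
  rw [Finset.mul_sum]
  refine Finset.sum_congr rfl fun φ _ => ?_
  rw [Finsupp.single_apply, ← GraphEquipment.star_mk]
  simp only [GraphEquipment.star_injective.eq_iff]
  split_ifs with h1 h2 h2
  · rw [h1]
  · exact (h2 h1.symm).elim
  · exact (h1 h2.symm).elim
  · simp

include hc in
theorem pairing_single_left (hne : q₁ ≠ q₂) (h : ∀ q, q = q₁ ∨ q = q₂)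
    (y : EquipmentSpace G X 𝕂 (Ω.vertexClass q₁).star)
    (ς : GraphEquipment G X (Ω.vertexClass q₁)) :
    pairing Ω q₁ q₂ hne h (equippedForm G X 𝕂 c Ω.toFilm) (Finsupp.single ς 1) y =
      y ς.star * (1 / (ς.aut c : 𝕂)) := by
  classical
  have := Fintype.ofFinite (GraphLabeling X (Ω.vertexClass q₁))
  rw [pairing_eq_sum hc, ← inv_groupOrder_mul_sum_orbit hc, mul_left_comm]
  congr 1
  rw [Finset.mul_sum]
  refine Finset.sum_congr rfl fun φ _ => ?_
  rw [Finsupp.single_apply, ← GraphEquipment.star_mk]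
  split_ifs with h1 h2 h2
  · rw [h1, mul_comm]
  · exact (h2 h1.symm).elim
  · exact (h1 h2.symm).elim
  · simp

include hc in
theorem one_div_aut_ne_zero {σ : GraphClass S} (ς : GraphEquipment G X σ) :
    (1 / (ς.aut c : 𝕂)) ≠ 0 := by
  have hF : FactorsThrough G (c σ.colors) (GraphLabeling X σ) :=
    (GraphLabeling.factorsThrough σ).mono (hc.subset _)
  have := hc.finite (T := σ.colors) σ.finite
  exact one_div_ne_zero (Nat.cast_ne_zero.2 (hF.autOrder_ne_zero ς))

include hc in
theorem pairing_nondegenerate (hne : q₁ ≠ q₂) (h : ∀ q, q = q₁ ∨ q = q₂) :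
    (∀ x, (∀ y, pairing Ω q₁ q₂ hne h (equippedForm G X 𝕂 c Ω.toFilm) x y = 0) → x = 0) ∧
    (∀ y, (∀ x, pairing Ω q₁ q₂ hne h (equippedForm G X 𝕂 c Ω.toFilm) x y = 0) → y = 0) := by
  constructor
  · intro x hx
    ext ς
    have := hx (Finsupp.single ς.star 1)
    rw [pairing_single_right hc] at this
    exact (mul_eq_zero.1 this).resolve_right (one_div_aut_ne_zero hc ς)
  · intro y hy
    ext ς
    obtain ⟨ς, rfl⟩ := ς.star_surjective
    have := hy (Finsupp.single ς 1)
    rw [pairing_single_left hc] at this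
    exact (mul_eq_zero.1 this).resolve_right (one_div_aut_ne_zero hc ς)

end Pairing

/-! ### Cuts -/

section Cut

variable {S : Type u} {G : S → Type w} {X : S → Type z} [∀ s, Group (G s)]
  [∀ s, MulAction (G s) (X s)] {Ω : ConnectedFilm S} {A : Set Ω.Vert} (hA : IsDivision A)

/-- The labeling of the part of the cut surface that is induced by a labeling of the surface. -/
def FilmLabeling.restrict (ψ : FilmLabeling X Ω) : FilmLabeling X (Ω.cut A hA) := fun e d =>
  ψ e.1 ⟨d.1.1, by
    obtain ⟨f, hf, hf'⟩ := d.2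
    exact ⟨f.1, congrArg Subtype.val hf, congrArg Subtype.val hf'⟩⟩

theorem FilmLabeling.side_restrict (ψ : FilmLabeling X Ω) (f : (Ω.cut A hA).Side) {s : S}
    (h : (Ω.cut A hA).color ((Ω.cut A hA).disk f) = s) :
    (ψ.restrict hA).side f h = ψ.side f.1 h := by
  subst h
  rfl

theorem ConnectedFilm.isEnd_cutVert {a : A} {s : S} {b : Bool} {f : (Ω.cut A hA).Side} :
    (Ω.cut A hA).IsEnd (Ω.cutVert A hA a) s b f ↔ Ω.IsEnd a s b f.1 := by
  have h1 : ∀ p, contract A p = some a ↔ p = a := by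
    intro p
    rw [← contract_of_mem a.2, contract_eq_contract]
    simp
  cases b
  · exact and_congr_right fun _ => h1 _
  · exact and_congr_right fun _ => h1 _

theorem ConnectedFilm.isEnd_cutPoint {s : S} {b : Bool} {f : (Ω.cut A hA).Side} :
    (Ω.cut A hA).IsEnd (Ω.cutPoint A hA) s b f ↔
      Ω.color (Ω.disk f.1) = s ∧ (if b then Ω.tail f.1 else Ω.head f.1) ∉ A := by
  have h1 : ∀ p, contract A p = none ↔ p ∉ A := by
    intro p
    by_cases hp : p ∈ A <;> simp [contract, hp]
  cases b
  · exact and_congr_right fun _ => h1 _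
  · exact and_congr_right fun _ => h1 _

/-- A side that leaves the new vertex of one part of the cut surface enters, as a side of the other
part, the new vertex of that part, and vice versa. -/
theorem ConnectedFilm.exists_isEnd_compl {s : S} {b : Bool} {f : (Ω.cut A hA).Side}
    (hf : (Ω.cut A hA).IsEnd (Ω.cutPoint A hA) s b f) :
    ∃ g : (Ω.cut Aᶜ hA.compl).Side, g.1 = f.1 ∧
      (Ω.cut Aᶜ hA.compl).IsEnd (Ω.cutPoint Aᶜ hA.compl) s (!b) g := by
  obtain ⟨h1, h2⟩ := (ConnectedFilm.isEnd_cutPoint hA).1 hf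
  cases b
  · refine ⟨⟨f.1, Or.inr h2⟩, rfl, (ConnectedFilm.isEnd_cutPoint _).2 ⟨h1, ?_⟩⟩
    exact not_not.2 (f.2.resolve_right h2)
  · refine ⟨⟨f.1, Or.inl h2⟩, rfl, (ConnectedFilm.isEnd_cutPoint _).2 ⟨h1, ?_⟩⟩
    exact not_not.2 (f.2.resolve_left h2)

theorem FilmLabeling.gen_restrict (ψ : FilmLabeling X Ω) (a : A) :
    GraphLabeling.cast (Ω.vertexClass_cutVert A hA a)
      ((ψ.restrict hA).gen (Ω.cutVert A hA a)) = ψ.gen a := by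
  funext s
  have hs : s.1 ∈ ((Ω.cut A hA).vertexClass (Ω.cutVert A hA a)).colors := by
    rw [Ω.vertexClass_cutVert A hA a]
    exact s.2
  have h1 := (Ω.cut A hA).isEnd_sideAt _ ⟨s, hs⟩ false
  have h2 := (Ω.cut A hA).isEnd_sideAt _ ⟨s, hs⟩ true
  rw [GraphLabeling.cast, gen_apply _ _ h1 h2, side_restrict, side_restrict,
    gen_apply _ _ ((ConnectedFilm.isEnd_cutVert hA).1 h1) ((ConnectedFilm.isEnd_cutVert hA).1 h2)]

/-- Labelings of the two parts of the cut surface generate labelings of the graphs of the new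
vertices that differ just by the orientation of the graph. -/
def CutMatch (ψ : FilmLabeling X (Ω.cut A hA)) (ψ' : FilmLabeling X (Ω.cut Aᶜ hA.compl)) : Prop :=
  GraphLabeling.cast (Ω.vertexClass_cutPoint A hA) (ψ'.gen (Ω.cutPoint Aᶜ hA.compl)) =
    (ψ.gen (Ω.cutPoint A hA)).star

/-- Labelings match if and only if they coincide on the two parts of every side that is cut. -/
theorem cutMatch_iff (ψ : FilmLabeling X (Ω.cut A hA))
    (ψ' : FilmLabeling X (Ω.cut Aᶜ hA.compl)) :
    CutMatch hA ψ ψ' ↔ ∀ (f : (Ω.cut A hA).Side) (f' : (Ω.cut Aᶜ hA.compl).Side)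
      (h : f'.1 = f.1), ψ.side f rfl = ψ'.side f' (congrArg (fun f => Ω.color (Ω.disk f)) h) := by
  constructor
  · rintro hm ⟨f, hf⟩ ⟨f', hf'⟩ h
    obtain rfl : f' = f := h
    have key : ∀ b, (Ω.cut A hA).IsEnd (Ω.cutPoint A hA) (Ω.color (Ω.disk f')) b ⟨f', hf⟩ →
        ψ.side ⟨f', hf⟩ rfl = ψ'.side ⟨f', hf'⟩ rfl := by
      intro b hb
      obtain ⟨⟨g, hg⟩, h1, h2⟩ := ConnectedFilm.exists_isEnd_compl hA hb
      obtain rfl : g = f' := h1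
      have hs := ((Ω.cut A hA).mem_colors_iff b).2 ⟨_, hb⟩
      have h3 := (Ω.cut A hA).isEnd_sideAt _ ⟨_, hs⟩ (!b)
      obtain ⟨k, hk, h4⟩ := ConnectedFilm.exists_isEnd_compl hA h3
      have h5 := congrFun hm ⟨_, GraphClass.mem_colors_star.2 hs⟩
      cases b
      · rw [GraphLabeling.cast, GraphLabeling.star, FilmLabeling.gen_apply _ _ hb h3,
          FilmLabeling.gen_apply _ _ h4 h2] at h5
        exact (congrArg Prod.snd h5).symm
      · rw [GraphLabeling.cast, GraphLabeling.star, FilmLabeling.gen_apply _ _ h3 hb,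
          FilmLabeling.gen_apply _ _ h2 h4] at h5
        exact (congrArg Prod.fst h5).symm
    -- a side in both parts has its tail and its head in different arcs
    by_cases ht : Ω.tail f' ∈ A
    · exact key false ((ConnectedFilm.isEnd_cutPoint hA).2
        ⟨rfl, hf'.resolve_left (not_not.2 ht)⟩)
    · exact key true ((ConnectedFilm.isEnd_cutPoint hA).2 ⟨rfl, ht⟩)
  · intro h
    have hs : ∀ (f : (Ω.cut A hA).Side) (f' : (Ω.cut Aᶜ hA.compl).Side) {s}
        (hf : (Ω.cut A hA).color ((Ω.cut A hA).disk f) = s)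
        (hf' : (Ω.cut Aᶜ hA.compl).color ((Ω.cut Aᶜ hA.compl).disk f') = s),
        f'.1 = f.1 → ψ'.side f' hf' = ψ.side f hf := by
      rintro f f' _ rfl hf' h'
      exact (h f f' h').symm
    funext s
    have h1 := (Ω.cut A hA).isEnd_sideAt _ ⟨_, GraphClass.mem_colors_star.1 s.2⟩ false
    have h2 := (Ω.cut A hA).isEnd_sideAt _ ⟨_, GraphClass.mem_colors_star.1 s.2⟩ true
    obtain ⟨f', hf', h1'⟩ := ConnectedFilm.exists_isEnd_compl hA h1
    obtain ⟨g', hg', h2'⟩ := ConnectedFilm.exists_isEnd_compl hA h2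
    rw [GraphLabeling.cast, GraphLabeling.star, FilmLabeling.gen_apply _ _ h1 h2,
      FilmLabeling.gen_apply _ _ h2' h1']
    exact Prod.ext (hs _ _ _ _ hg') (hs _ _ _ _ hf')

theorem FilmLabeling.cutMatch_restrict (ψ : FilmLabeling X Ω) :
    CutMatch hA (ψ.restrict hA) (ψ.restrict hA.compl) := by
  rw [cutMatch_iff]
  exact fun f f' h => ψ.side_congr h.symm rfl

/-- A labeling of `Ω` is the same as a matching pair of labelings of the two parts of the cut
surface: every side of `Ω` lies in one of the parts, and the sides in both of them are those that
are cut. -/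
theorem FilmLabeling.restrict_bijective :
    Function.Bijective (fun ψ : FilmLabeling X Ω => (⟨(ψ.restrict hA, ψ.restrict hA.compl),
      ψ.cutMatch_restrict hA⟩ :
      {p : FilmLabeling X (Ω.cut A hA) × FilmLabeling X (Ω.cut Aᶜ hA.compl) //
        CutMatch hA p.1 p.2})) := by
  classical
  constructor
  · intro ψ₁ ψ₂ h
    simp only [Subtype.mk.injEq, Prod.mk.injEq] at h
    refine FilmLabeling.ext_side fun f => ?_
    by_cases hf : Ω.tail f ∈ A
    · exact congrArg (fun ψ : FilmLabeling X (Ω.cut A hA) => ψ.side ⟨f, Or.inl hf⟩ rfl) h.1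
    · exact congrArg (fun ψ : FilmLabeling X (Ω.cut Aᶜ hA.compl) =>
        ψ.side ⟨f, Or.inl hf⟩ rfl) h.2
  · rintro ⟨⟨ψ₁, ψ₂⟩, h⟩
    rw [cutMatch_iff] at h
    obtain ⟨ψ, hψ⟩ := FilmLabeling.exists_side_eq fun f : Ω.Side =>
      if hf : Ω.tail f ∈ A then ψ₁.side (Ω := Ω.cut A hA) (s := Ω.color (Ω.disk f))
        ⟨f, Or.inl hf⟩ rfl
      else ψ₂.side (Ω := Ω.cut Aᶜ hA.compl) (s := Ω.color (Ω.disk f)) ⟨f, Or.inl hf⟩ rfl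
    refine ⟨ψ, Subtype.ext (Prod.ext (FilmLabeling.ext_side fun f => ?_)
      (FilmLabeling.ext_side fun f => ?_))⟩
    · rw [side_restrict]
      refine (hψ f.1).trans ?_
      split_ifs with hf
      · rfl
      · exact (h f ⟨f.1, Or.inl hf⟩ rfl).symm
    · rw [side_restrict]
      refine (hψ f.1).trans ?_
      split_ifs with hf
      · exact h ⟨f.1, Or.inl hf⟩ f rfl
      · rfl

theorem ConnectedFilm.range_color_union : Set.range (Ω.cut A hA).color ∪
    Set.range (Ω.cut Aᶜ hA.compl).color = Set.range Ω.color := by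
  refine Set.Subset.antisymm ?_ ?_
  · rintro _ (⟨d, rfl⟩ | ⟨d, rfl⟩)
    · exact ⟨d.1, rfl⟩
    · exact ⟨d.1, rfl⟩
  · rintro _ ⟨d, rfl⟩
    obtain ⟨f, rfl⟩ := Ω.disk_surjective d
    by_cases hf : Ω.tail f ∈ A
    · exact Or.inl ⟨⟨Ω.disk f, f, rfl, hf⟩, rfl⟩
    · exact Or.inr ⟨⟨Ω.disk f, f, rfl, hf⟩, rfl⟩

/-- The disks that are cut are the disks with vertices in both arcs. -/
theorem ConnectedFilm.range_color_inter : Set.range (Ω.cut A hA).color ∩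
    Set.range (Ω.cut Aᶜ hA.compl).color =
      ((Ω.cut A hA).vertexClass (Ω.cutPoint A hA)).colors := by
  refine Set.Subset.antisymm ?_ (Set.subset_inter (ConnectedFilm.colors_subset _) ?_)
  · rintro _ ⟨⟨⟨d, f₀, hf₀, h₀⟩, rfl⟩, ⟨⟨d', f₁, hf₁, h₁⟩, hd⟩⟩
    obtain rfl : d' = d := Ω.color_injective hd
    obtain ⟨f, h2, h3, h4⟩ := Ω.exists_enter (hf₁.trans hf₀.symm) h₀ h₁
    exact ((Ω.cut A hA).mem_colors_iff true).2 ⟨⟨f, Or.inr h4⟩,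
      (ConnectedFilm.isEnd_cutPoint hA).2 ⟨congrArg _ (h2.trans hf₀), h3⟩⟩
  · intro s hs
    obtain ⟨f, hf⟩ := ((Ω.cut A hA).mem_colors_iff true).1 hs
    obtain ⟨g, -, hg⟩ := ConnectedFilm.exists_isEnd_compl hA hf
    exact ⟨_, hg.1⟩

variable {𝕂 : Type v} [Field 𝕂]

/-- The factors of the state sum of a part of the cut surface that belong to the old vertices. -/
noncomputable def oldWeight (x : ∀ q, EquipmentSpace G X 𝕂 (Ω.vertexClass q))
    (ψ : FilmLabeling X (Ω.cut A hA)) : 𝕂 :=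
  ∏ᶠ a : A, x a (Quotient.mk'' (GraphLabeling.cast (Ω.vertexClass_cutVert A hA a)
    (ψ.gen (Ω.cutVert A hA a))))

theorem oldWeight_smul (x : ∀ q, EquipmentSpace G X 𝕂 (Ω.vertexClass q)) (g : ColorGroup G)
    (ψ : FilmLabeling X (Ω.cut A hA)) : oldWeight hA x (g • ψ) = oldWeight hA x ψ := by
  refine finprod_congr fun a => congrArg _ ?_
  rw [FilmLabeling.gen_smul, GraphLabeling.cast_smul]
  exact Quotient.eq''.2 (MulAction.orbitRel_apply.2 ⟨g, rfl⟩)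

theorem oldWeight_restrict_mul [Fintype Ω.Vert]
    (x : ∀ q, EquipmentSpace G X 𝕂 (Ω.vertexClass q)) (ψ : FilmLabeling X Ω) :
    oldWeight hA x (ψ.restrict hA) * oldWeight hA.compl x (ψ.restrict hA.compl) =
      ∏ q, x q (Quotient.mk'' (ψ.gen q)) := by
  classical
  simp only [oldWeight, FilmLabeling.gen_restrict, finprod_eq_prod_of_fintype]
  exact Fintype.prod_subtype_mul_prod_subtype (· ∈ A) fun q => x q (Quotient.mk'' (ψ.gen q))

/-- The state sum of a part of the cut surface, with the factor of the new vertex split off. -/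
theorem stateSum_cut [∀ s, Finite (X s)] (c : Set S → Set S) [Fintype (FilmLabeling X (Ω.cut A hA))]
    (x : ∀ q, EquipmentSpace G X 𝕂 (Ω.vertexClass q))
    (y : ∀ q, EquipmentSpace G X 𝕂 ((Ω.cut A hA).vertexClass q))
    (hy : ∀ a : A, y (Ω.cutVert A hA a) = LinearEquiv.cast (R := 𝕂) (M := EquipmentSpace G X 𝕂)
      (Ω.vertexClass_cutVert A hA a).symm (x a)) :
    stateSum c (Ω.cut A hA) y = (groupOrder G 𝕂 c (Set.range (Ω.cut A hA).color))⁻¹ *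
      ∑ ψ : FilmLabeling X (Ω.cut A hA),
        y (Ω.cutPoint A hA) (Quotient.mk'' (ψ.gen (Ω.cutPoint A hA))) * oldWeight hA x ψ := by
  have := Fintype.ofFinite A
  let _ : Fintype (Ω.cut A hA).Vert := inferInstanceAs (Fintype (Option A))
  rw [stateSum_eq_sum]
  congr 1
  refine Finset.sum_congr rfl fun ψ _ => ?_
  rw [oldWeight, finprod_eq_prod_of_fintype]
  refine (Fintype.prod_option (fun q : Option A => y q (Quotient.mk'' (ψ.gen q)))).trans ?_
  congr 1
  refine Finset.prod_congr rfl fun a _ => ?_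
  exact (DFunLike.congr_fun (hy a) _).trans (cast_apply_mk _ _ _)

variable {c : Set S → Set S} (hc : StabilizerConvention G c)

open Classical in
include hc in
/-- The weight `|Aut|` in the tensor counts the group elements that make two labelings match. -/
theorem sum_transporter_eq_aut (σ : GraphClass S) [Fintype (supportSubgroup G (c σ.colors))]
    (φ : GraphLabeling X σ) (φ' : GraphLabeling X σ.star) :
    (∑ k : supportSubgroup G (c σ.colors), if k • φ' = φ.star then 1 else 0 : 𝕂) =
      if GraphEquipment.star (Quotient.mk'' φ : GraphEquipment G X σ) = Quotient.mk'' φ'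
      then (GraphEquipment.aut c (Quotient.mk'' φ : GraphEquipment G X σ) : 𝕂) else 0 := by
  have hF : FactorsThrough G (c σ.colors) (GraphLabeling X σ) :=
    (GraphLabeling.factorsThrough σ).mono (hc.subset _)
  obtain ⟨φ', rfl⟩ := φ'.star_surjective
  have h1 : ∀ k : supportSubgroup G (c σ.colors), k • φ'.star = φ.star ↔ k • φ' = φ := fun k =>
    GraphLabeling.star_injective.eq_iff (a := k • φ')
  have h2 := hF.card_transporter φ' φ
  rw [Nat.card_eq_fintype_card, Fintype.card_subtype] at h2
  simp only [h1]
  rw [Finset.sum_boole, h2, ← GraphEquipment.star_mk, Nat.cast_ite, Nat.cast_zero]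
  exact if_congr (eq_comm.trans GraphEquipment.star_injective.eq_iff.symm) rfl rfl

variable [∀ s, Finite (G s)]

open Classical in
include hc in
/-- The contraction with the tensor `∑ |Aut ς| ς ⊗ ς*`, summed over `ς`: only matching pairs of
labelings of the two parts remain, each of them as often as the group has elements. -/
theorem sum_aut_mul_eq_sum_cutMatch (x : ∀ q, EquipmentSpace G X 𝕂 (Ω.vertexClass q))
    [Fintype (GraphEquipment G X ((Ω.cut A hA).vertexClass (Ω.cutPoint A hA)))]
    [Fintype (FilmLabeling X (Ω.cut A hA))] [Fintype (FilmLabeling X (Ω.cut Aᶜ hA.compl))] :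
    ∑ ς : GraphEquipment G X ((Ω.cut A hA).vertexClass (Ω.cutPoint A hA)), (ς.aut c : 𝕂) *
      ((∑ ψ : FilmLabeling X (Ω.cut A hA),
        (if ς = Quotient.mk'' (ψ.gen (Ω.cutPoint A hA)) then 1 else 0) * oldWeight hA x ψ) *
      ∑ ψ' : FilmLabeling X (Ω.cut Aᶜ hA.compl),
        (if ς.star = Quotient.mk'' (GraphLabeling.cast (Ω.vertexClass_cutPoint A hA)
          (ψ'.gen (Ω.cutPoint Aᶜ hA.compl))) then 1 else 0) * oldWeight hA.compl x ψ') =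
    groupOrder G 𝕂 c ((Ω.cut A hA).vertexClass (Ω.cutPoint A hA)).colors *
      ∑ ψ : FilmLabeling X (Ω.cut A hA), ∑ ψ' : FilmLabeling X (Ω.cut Aᶜ hA.compl),
        if CutMatch hA ψ ψ' then oldWeight hA x ψ * oldWeight hA.compl x ψ' else 0 := by
  let T := ((Ω.cut A hA).vertexClass (Ω.cutPoint A hA)).colors
  have := hc.finite (T := T) (GraphClass.finite _)
  have := Fintype.ofFinite (supportSubgroup G (c T))
  calc
    _ = ∑ ψ : FilmLabeling X (Ω.cut A hA), ∑ ψ' : FilmLabeling X (Ω.cut Aᶜ hA.compl),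
        (∑ k : supportSubgroup G (c T),
          if k • GraphLabeling.cast (Ω.vertexClass_cutPoint A hA)
            (ψ'.gen (Ω.cutPoint Aᶜ hA.compl)) = (ψ.gen (Ω.cutPoint A hA)).star then 1 else 0) *
          (oldWeight hA x ψ * oldWeight hA.compl x ψ') := by
      simp only [T, sum_transporter_eq_aut hc, Finset.sum_mul_sum]
      simp only [Finset.mul_sum]
      rw [Finset.sum_comm]
      refine Finset.sum_congr rfl fun ψ _ => ?_
      rw [Finset.sum_comm]
      refine Finset.sum_congr rfl fun ψ' _ => ?_
      rw [Finset.sum_eq_single (Quotient.mk'' (ψ.gen (Ω.cutPoint A hA)))]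
      · rw [if_pos rfl]
        split_ifs <;> ring
      · intro ς _ h
        rw [if_neg h]
        ring
      · simp
    _ = ∑ k : supportSubgroup G (c T), ∑ ψ : FilmLabeling X (Ω.cut A hA),
        ∑ ψ' : FilmLabeling X (Ω.cut Aᶜ hA.compl), if CutMatch hA ψ ((k : ColorGroup G) • ψ')
          then oldWeight hA x ψ * oldWeight hA.compl x ((k : ColorGroup G) • ψ') else 0 := by
      simp only [Finset.sum_mul]
      rw [Finset.sum_congr rfl fun ψ _ => Finset.sum_comm, Finset.sum_comm]
      refine Finset.sum_congr rfl fun k _ => Finset.sum_congr rfl fun ψ _ =>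
        Finset.sum_congr rfl fun ψ' _ => ?_
      rw [oldWeight_smul, CutMatch, FilmLabeling.gen_smul, GraphLabeling.cast_smul, ite_mul,
        one_mul, zero_mul]
      rfl
    _ = _ := by
      -- the summands depend only on `k • ψ'`, so that `k` may be removed by a change of variables
      have h1 : ∀ (k : ColorGroup G) (F : FilmLabeling X (Ω.cut Aᶜ hA.compl) → 𝕂),
          ∑ ψ', F (k • ψ') = ∑ ψ', F ψ' := fun k F => Equiv.sum_comp (MulAction.toPerm k) F
      refine (Finset.sum_congr rfl fun (k : supportSubgroup G (c T)) _ => Finset.sum_congr rfl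
        fun ψ _ => h1 k.1 fun ψ' =>
        if CutMatch hA ψ ψ' then oldWeight hA x ψ * oldWeight hA.compl x ψ' else 0).trans ?_
      rw [Finset.sum_const, nsmul_eq_mul, Finset.card_univ, ← Nat.card_eq_fintype_card]
      rfl

variable [∀ s, Finite (X s)] [CharZero 𝕂]

include hc in
/-- The invariance under cuts. -/
theorem equippedForm_cut (x : ∀ q, EquipmentSpace G X 𝕂 (Ω.vertexClass q)) :
    TensorProduct.lift (cutForm Ω A hA (equippedForm G X 𝕂 c (Ω.cutFilm A hA)) x)
      (equippedTensor G X 𝕂 c ((Ω.cut A hA).vertexClass (Ω.cutPoint A hA))) =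
    equippedForm G X 𝕂 c Ω.toFilm fun q => x q.2 := by
  classical
  have := Fintype.ofFinite Ω.Vert
  have := Fintype.ofFinite (FilmLabeling X Ω)
  have := Fintype.ofFinite (FilmLabeling X (Ω.cut A hA))
  have := Fintype.ofFinite (FilmLabeling X (Ω.cut Aᶜ hA.compl))
  have := Fintype.ofFinite
    (GraphEquipment G X ((Ω.cut A hA).vertexClass (Ω.cutPoint A hA)))
  have h1 : ∀ y z, cutForm Ω A hA (equippedForm G X 𝕂 c (Ω.cutFilm A hA)) x y z =
      ((groupOrder G 𝕂 c (Set.range (Ω.cut A hA).color))⁻¹ *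
      ∑ ψ : FilmLabeling X (Ω.cut A hA),
        y (Quotient.mk'' (ψ.gen (Ω.cutPoint A hA))) * oldWeight hA x ψ) *
      ((groupOrder G 𝕂 c (Set.range (Ω.cut Aᶜ hA.compl).color))⁻¹ *
      ∑ ψ' : FilmLabeling X (Ω.cut Aᶜ hA.compl),
        z (Quotient.mk'' (GraphLabeling.cast (Ω.vertexClass_cutPoint A hA)
          (ψ'.gen (Ω.cutPoint Aᶜ hA.compl)))) * oldWeight hA.compl x ψ') := by
    intro y z
    refine (equippedForm_disjUnion hc _ _ _).trans (congrArg₂ (· * ·) ?_ ?_)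
    · refine (equippedForm_toFilm hc _ _).trans ?_
      exact stateSum_cut hA c x _ fun a => rfl
    · refine (equippedForm_toFilm hc _ _).trans ?_
      refine (stateSum_cut hA.compl c x _ fun a => rfl).trans ?_
      congr 1
      refine Finset.sum_congr rfl fun ψ' _ => congrArg (· * _) ?_
      exact cast_apply_mk _ _ _
  have hσ := Set.finite_range (Ω.cut A hA).color
  have hσ' := Set.finite_range (Ω.cut Aᶜ hA.compl).color
  have h2 : groupOrder G 𝕂 c (Set.range Ω.color) *
      groupOrder G 𝕂 c ((Ω.cut A hA).vertexClass (Ω.cutPoint A hA)).colors =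
      groupOrder G 𝕂 c (Set.range (Ω.cut A hA).color) *
        groupOrder G 𝕂 c (Set.range (Ω.cut Aᶜ hA.compl).color) := by
    have := hc.card_union_inter hσ hσ'
    rw [ConnectedFilm.range_color_union, ConnectedFilm.range_color_inter] at this
    simp only [groupOrder]
    exact_mod_cast this
  have h3 := hc.groupOrder_ne_zero (𝕂 := 𝕂) hσ
  have h4 := hc.groupOrder_ne_zero (𝕂 := 𝕂) hσ'
  have h5 := hc.groupOrder_ne_zero (𝕂 := 𝕂) (Set.finite_range Ω.color)
  have h6 : (∑ ψ : FilmLabeling X (Ω.cut A hA), ∑ ψ' : FilmLabeling X (Ω.cut Aᶜ hA.compl),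
      if CutMatch hA ψ ψ' then oldWeight hA x ψ * oldWeight hA.compl x ψ' else 0) =
      ∑ ψ : FilmLabeling X Ω, ∏ q, x q (Quotient.mk'' (ψ.gen q)) := by
    rw [← Fintype.sum_prod_type' fun ψ ψ' =>
      if CutMatch hA ψ ψ' then oldWeight hA x ψ * oldWeight hA.compl x ψ' else 0,
      ← Finset.sum_filter, Finset.sum_subtype (p := fun p : FilmLabeling X (Ω.cut A hA) ×
        FilmLabeling X (Ω.cut Aᶜ hA.compl) => CutMatch hA p.1 p.2) _ (by simp)]
    refine (Fintype.sum_bijective _ (FilmLabeling.restrict_bijective hA) _ _ fun ψ => ?_).symm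
    exact (oldWeight_restrict_mul hA x ψ).symm
  rw [equippedTensor, finsum_eq_sum_of_fintype, map_sum]
  simp only [map_smul, TensorProduct.lift.tmul, h1, Finsupp.single_apply, smul_eq_mul]
  have h7 := sum_aut_mul_eq_sum_cutMatch hA hc x
  rw [h6] at h7
  rw [equippedForm_toFilm hc, stateSum_eq_sum]
  generalize (∑ ψ : FilmLabeling X Ω, ∏ q, x q (Quotient.mk'' (ψ.gen q))) = Z at h7 ⊢
  have h8 : ∀ a b p q r : 𝕂, r * (a⁻¹ * p * (b⁻¹ * q)) = (a * b)⁻¹ * (r * (p * q)) := by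
    intro a b p q r
    rw [mul_inv]
    ring
  refine (Finset.sum_congr rfl fun ς _ => h8 _ _ _ _ _).trans ?_
  rw [← Finset.mul_sum, h7, eq_inv_mul_iff_mul_eq₀ h5, mul_left_comm, ← mul_assoc _ _ Z, h2,
    ← mul_assoc, inv_mul_cancel₀ (mul_ne_zero h3 h4), one_mul]

end Cut

theorem lemma6p1 {S : Type u} (G : S → Type w) (X : S → Type z) [∀ s, Group (G s)]
    [∀ s, MulAction (G s) (X s)] [∀ s, Finite (G s)] [∀ s, Finite (X s)]
    (𝕂 : Type v) [Field 𝕂] [CharZero 𝕂] (c : Set S → Set S)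
    (hc : c = id ∨ (c = fun _ => Set.univ) ∧ Finite (ColorGroup G)) :
    (∀ (Ω : ConnectedFilm S) (ς : ∀ q, GraphEquipment G X (Ω.vertexClass q)),
      equippedForm G X 𝕂 c Ω.toFilm (fun q => Finsupp.single (ς q.2) 1) =
        equippedSum G X 𝕂 c Ω ς) ∧
    IsFilmTFT (B := EquipmentSpace G X 𝕂) (equippedTensor G X 𝕂 c) (equippedForm G X 𝕂 c) ∧
    ∀ (Ω : ConnectedFilm S) (q₁ q₂ : Ω.Vert) (hne : q₁ ≠ q₂) (h : ∀ q, q = q₁ ∨ q = q₂)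
      (ς₁ ς₂ : GraphEquipment G X (Ω.vertexClass q₁)),
      (ς₁ = ς₂ → pairing Ω q₁ q₂ hne h (equippedForm G X 𝕂 c Ω.toFilm)
        (Finsupp.single ς₁ 1) (Finsupp.single ς₂.star 1) = 1 / (ς₁.aut c : 𝕂)) ∧
      (ς₁ ≠ ς₂ → pairing Ω q₁ q₂ hne h (equippedForm G X 𝕂 c Ω.toFilm)
        (Finsupp.single ς₁ 1) (Finsupp.single ς₂.star 1) = 0) := by
  have hc : StabilizerConvention G c := hc
  refine ⟨equippedForm_single hc, ⟨fun σ => inferInstance, ?_, ?_, ?_, equippedForm_disjUnion hc⟩,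
    fun Ω q₁ q₂ hne h ς₁ ς₂ => ⟨?_, fun h' => ?_⟩⟩
  · intro Ω Ω' φ x x' h
    rw [equippedForm_apply hc, equippedForm_apply hc, ← φ.comp.prod_comp]
    exact Finset.prod_congr rfl fun i _ => stateSum_iso c (φ.iso i) _ _ fun q => h ⟨i, q⟩
  · intro Ω q₁ q₂ hne h
    exact pairing_nondegenerate hc hne h
  · intro Ω A hA x
    exact equippedForm_cut hA hc x
  · rintro rfl
    rw [pairing_single_right hc, Finsupp.single_eq_same, one_mul]
  · rw [pairing_single_right hc, Finsupp.single_eq_of_ne h'.symm, zero_mul]
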